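/- Let $I=[0,1]$. Let $L_1(I)$ be the space of complex-valued integrable functions on $I$ with norm $\|\cdot\|_0$. For $k\ge 1$ let $W^k_1(I)$ be the space of those $u\in L_1(I)$ whose weak derivatives up to order $k$ belong to $L_1(I)$, and equip $W^1_1(I)$ with the norm $\|u\|_1=\|u\|_0+\|\partial_x u\|_0$. Let $A^1_0$ be the Neumann Laplacian in $W^1_1(I)$, that is, the operator $$A^1_0u=\partial_{xx}u,\qquad D(A^1_0)=\{u\in W^3_1(I):\ \partial_xu(0)=\partial_xu(1)=0\},$$ where boundary values are those of the continuous representative. For $\theta_0<\pi$ put $\Sigma_{\theta_0}=\{\lambda=|\lambda|e^{i\theta}\in\mathbb C:\ |\theta|\le\theta_0\}$. **Proposition.** The operator $A^1_0$ generates an analytic semigroup in $W^1_1(I)$. Moreover, for every $\theta_0<\pi$, each $\lambda\in\Sigma_{\theta_0}$ with $\lambda\ne 0$ belongs to the resolvent set of $A^1_0$, and the resolvent $R(\lambda,A^1_0)=(\lambda-A^1_0)^{-1}$ satisfies $$\|R(\lambda,A^1_0)f\|_1\le\frac{2\|f\|_1}{|\lambda|\cos(\theta_0/2)}\qquad\text{for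 all } f\in W^1_1(I).$$ -/

import Mathlib

open MeasureTheory Set Filter Topology
open scoped ContDiff ENNReal

noncomputable section

namespace NeumannW11

/-! ### Abstract operator theory: resolvents and analytic semigroups -/

section Abstract

variable {X : Type*} [NormedAddCommGroup X] [NormedSpace ℂ X]

/-- The bounded operator `R` is the two-sided inverse of `l - A : D(A) → X`. -/
def IsResolventAt (A : X →ₗ.[ℂ] X) (l : ℂ) (R : X →L[ℂ] X) : Prop :=
  (∀ f : X, ∃ h : R f ∈ A.domain, l • R f - A ⟨R f, h⟩ = f) ∧
    ∀ u : A.domain, R (l • (u : X) - A u) = u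

/-- The resolvent set `ρ(A)` of a (possibly unbounded) operator `A`. -/
def resolventSet (A : X →ₗ.[ℂ] X) : Set ℂ :=
  {l | ∃ R : X →L[ℂ] X, IsResolventAt A l R}

open Classical in
/-- The resolvent `R(l, A) = (l - A)⁻¹`, with the value `0` for `l` outside `ρ(A)`. -/
def resolvent (A : X →ₗ.[ℂ] X) (l : ℂ) : X →L[ℂ] X :=
  if h : l ∈ resolventSet A then h.choose else 0

theorem isResolventAt_resolvent {A : X →ₗ.[ℂ] X} {l : ℂ} (h : l ∈ resolventSet A) :
    IsResolventAt A l (resolvent A l) := by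
  rw [resolvent, dif_pos h]
  exact h.choose_spec

theorem IsResolventAt.eq_resolvent {A : X →ₗ.[ℂ] X} {l : ℂ} {R : X →L[ℂ] X}
    (h : IsResolventAt A l R) : R = resolvent A l := by
  ext f
  obtain ⟨hm, hf⟩ := (isResolventAt_resolvent ⟨R, h⟩).1 f
  have := h.2 ⟨_, hm⟩
  rw [hf] at this
  exact this

/-- The open sector `{z ≠ 0 : |arg z| < δ}`. -/
def openSector (δ : ℝ) : Set ℂ := {z | z ≠ 0 ∧ |z.arg| < δ}

/-- The family `T(z)`, `z ∈ openSector δ ∪ {0}`, is an analytic semigroup of angle `δ` of bounded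
operators on `X` (the values of `T` elsewhere play no role). -/
structure IsAnalyticSemigroup (δ : ℝ) (T : ℂ → X →L[ℂ] X) : Prop where
  map_zero : T 0 = ContinuousLinearMap.id ℂ X
  map_add : ∀ z ∈ openSector δ, ∀ w ∈ openSector δ, T (z + w) = (T z).comp (T w)
  analytic : AnalyticOnNhd ℂ T (openSector δ)
  tendsto_zero : ∀ δ' : ℝ, 0 < δ' → δ' < δ → ∀ x : X,
    Tendsto (fun z => T z x) (𝓝[openSector δ'] 0) (𝓝 x)

/-- `A` is the infinitesimal generator of `(T(t))_{t ≥ 0}`: an element `x` belongs to `D(A)` and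
`A x = y` exactly when `(T(t) x - x) / t → y` as `t ↓ 0`. -/
def IsGenerator (A : X →ₗ.[ℂ] X) (T : ℂ → X →L[ℂ] X) : Prop :=
  ∀ x y : X, (x, y) ∈ A.graph ↔
    Tendsto (fun t : ℝ => ((t : ℂ))⁻¹ • (T (t : ℂ) x - x)) (𝓝[>] 0) (𝓝 y)

/-- `A` generates an analytic semigroup on `X` (of some angle `δ ∈ (0, π/2]`). -/
def GeneratesAnalyticSemigroup (A : X →ₗ.[ℂ] X) : Prop :=
  ∃ δ : ℝ, 0 < δ ∧ δ ≤ Real.pi / 2 ∧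
    ∃ T : ℂ → X →L[ℂ] X, IsAnalyticSemigroup δ T ∧ IsGenerator A T

end Abstract

/-! ### Sobolev spaces on the unit interval -/

/-- The space `L_1(I)` of complex valued functions on the unit interval. -/
abbrev L1 : Type := Lp ℂ 1 (volume.restrict (Ioo (0 : ℝ) 1))

/-- `g ∈ L_1(I)` is the weak derivative of `u ∈ L_1(I)` on `]0,1[`. -/
def IsWeakDeriv (u g : L1) : Prop :=
  ∀ φ : ℝ → ℝ, ContDiff ℝ ∞ φ → HasCompactSupport φ → tsupport φ ⊆ Ioo (0 : ℝ) 1 →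
    ∫ x in Ioo (0 : ℝ) 1, deriv φ x • u x = -∫ x in Ioo (0 : ℝ) 1, φ x • g x

theorem integrable_smul_L1 (u : L1) {φ : ℝ → ℝ} (hφ : Continuous φ) (hc : HasCompactSupport φ) :
    Integrable (fun x => φ x • u x) (volume.restrict (Ioo (0 : ℝ) 1)) := by
  obtain ⟨C, hC⟩ := hφ.bounded_above_of_compact_support hc
  exact (L1.integrable_coeFn u).bdd_smul C hφ.aestronglyMeasurable (ae_of_all _ hC)

theorem IsWeakDeriv.zero : IsWeakDeriv 0 0 := by
  intro φ _ _ _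
  have h : ∀ ψ : ℝ → ℝ, ∫ x in Ioo (0 : ℝ) 1, ψ x • (0 : L1) x = 0 := by
    intro ψ
    refine integral_eq_zero_of_ae ?_
    filter_upwards [Lp.coeFn_zero ℂ 1 (volume.restrict (Ioo (0 : ℝ) 1))] with x hx
    rw [hx, Pi.zero_apply, smul_zero]
  rw [h, h, neg_zero]

theorem IsWeakDeriv.add {u₁ g₁ u₂ g₂ : L1} (h₁ : IsWeakDeriv u₁ g₁) (h₂ : IsWeakDeriv u₂ g₂) :
    IsWeakDeriv (u₁ + u₂) (g₁ + g₂) := by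
  intro φ hφ hc hs
  have key : ∀ (ψ : ℝ → ℝ), Continuous ψ → HasCompactSupport ψ → ∀ a b : L1,
      ∫ x in Ioo (0 : ℝ) 1, ψ x • (a + b : L1) x =
        (∫ x in Ioo (0 : ℝ) 1, ψ x • a x) + ∫ x in Ioo (0 : ℝ) 1, ψ x • b x := by
    intro ψ hψ hψc a b
    rw [← integral_add (integrable_smul_L1 a hψ hψc) (integrable_smul_L1 b hψ hψc)]
    refine integral_congr_ae ?_
    filter_upwards [Lp.coeFn_add a b] with x hx
    rw [hx, Pi.add_apply, smul_add]
  rw [key _ (hφ.continuous_deriv (by simp)) hc.deriv, key _ hφ.continuous hc, h₁ φ hφ hc hs,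
    h₂ φ hφ hc hs]
  ring

theorem IsWeakDeriv.smul {u g : L1} (c : ℂ) (h : IsWeakDeriv u g) :
    IsWeakDeriv (c • u) (c • g) := by
  intro φ hφ hc hs
  have key : ∀ (ψ : ℝ → ℝ) (a : L1), ∫ x in Ioo (0 : ℝ) 1, ψ x • (c • a : L1) x =
      c • ∫ x in Ioo (0 : ℝ) 1, ψ x • a x := by
    intro ψ a
    rw [← integral_smul]
    refine integral_congr_ae ?_
    filter_upwards [Lp.coeFn_smul c a] with x hx
    simp [hx]
    ring
  rw [key, key, h φ hφ hc hs, smul_neg]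

/-- Weak derivatives are unique. -/
theorem IsWeakDeriv.unique {u g₁ g₂ : L1} (h₁ : IsWeakDeriv u g₁) (h₂ : IsWeakDeriv u g₂) :
    g₁ = g₂ := by
  have h0 : IsWeakDeriv 0 (g₁ - g₂) := by
    have := h₁.add (h₂.smul (-1))
    simpa [sub_eq_add_neg] using this
  have hz : ∀ᵐ x ∂(volume.restrict (Ioo (0 : ℝ) 1)), x ∈ Ioo (0 : ℝ) 1 → (g₁ - g₂ : L1) x = 0 := by
    refine isOpen_Ioo.ae_eq_zero_of_integral_contDiff_smul_eq_zero
      ((L1.integrable_coeFn (g₁ - g₂)).locallyIntegrable.locallyIntegrableOn _) ?_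
    intro φ hφ hc hs
    have h := h0 φ hφ hc hs
    have hl : ∫ x in Ioo (0 : ℝ) 1, deriv φ x • (0 : L1) x = 0 := by
      refine integral_eq_zero_of_ae ?_
      filter_upwards [Lp.coeFn_zero ℂ 1 (volume.restrict (Ioo (0 : ℝ) 1))] with x hx
      rw [hx, Pi.zero_apply, smul_zero]
    rw [hl] at h
    exact neg_eq_zero.mp h.symm
  rw [← sub_eq_zero]
  refine Lp.ext ?_
  filter_upwards [hz, ae_restrict_mem measurableSet_Ioo,
    Lp.coeFn_zero ℂ 1 (volume.restrict (Ioo (0 : ℝ) 1))] with x hx hm hx0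
  rw [hx hm, hx0, Pi.zero_apply]

/-- `u ∈ W^k_1(I)`: `u` has weak derivatives in `L_1(I)` up to the order `k`. -/
def MemSobolev : ℕ → L1 → Prop
  | 0, _ => True
  | k + 1, u => ∃ g : L1, IsWeakDeriv u g ∧ MemSobolev k g

theorem MemSobolev.zero : ∀ k : ℕ, MemSobolev k 0
  | 0 => trivial
  | k + 1 => ⟨0, IsWeakDeriv.zero, MemSobolev.zero k⟩

theorem MemSobolev.add : ∀ {k : ℕ} {u v : L1}, MemSobolev k u → MemSobolev k v →
    MemSobolev k (u + v)
  | 0, _, _, _, _ => trivial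
  | _ + 1, _, _, ⟨g, hg, hk⟩, ⟨g', hg', hk'⟩ => ⟨g + g', hg.add hg', hk.add hk'⟩

theorem MemSobolev.smul (c : ℂ) : ∀ {k : ℕ} {u : L1}, MemSobolev k u → MemSobolev k (c • u)
  | 0, _, _ => trivial
  | _ + 1, _, ⟨g, hg, hk⟩ => ⟨c • g, hg.smul c, hk.smul c⟩

/-- The pairs `(u, ∂u)` with `u ∈ W^1_1(I)`, inside `L_1(I) × L_1(I)` with the sum norm. -/
def W11Submodule : Submodule ℂ (WithLp 1 (L1 × L1)) where
  carrier := {p | IsWeakDeriv p.fst p.snd}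
  zero_mem' := IsWeakDeriv.zero
  add_mem' h₁ h₂ := IsWeakDeriv.add h₁ h₂
  smul_mem' c _ h := IsWeakDeriv.smul c h

/-- The Sobolev space `W^1_1(I)`. An element is a function `u ∈ L_1(I)` together with its (unique)
weak derivative `∂u ∈ L_1(I)`; the norm is `‖u‖ = ‖u‖_{L_1} + ‖∂u‖_{L_1}`. -/
abbrev W11 : Type := ↥W11Submodule

/-- The underlying function of an element of `W^1_1(I)`. -/
def W11.toL1 (u : W11) : L1 := (u : WithLp 1 (L1 × L1)).fst

/-- The weak derivative of an element of `W^1_1(I)`. -/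
def W11.deriv (u : W11) : L1 := (u : WithLp 1 (L1 × L1)).snd

theorem W11.isWeakDeriv (u : W11) : IsWeakDeriv u.toL1 u.deriv := u.2

theorem W11.norm_eq (u : W11) : ‖u‖ = ‖u.toL1‖ + ‖u.deriv‖ := by
  have := WithLp.prod_norm_eq_of_nat (p := 1) 1 (by simp) (u : WithLp 1 (L1 × L1))
  simpa [W11.toL1, W11.deriv] using this

theorem W11.ext_toL1 {u v : W11} (h : u.toL1 = v.toL1) : u = v := by
  have h2 : u.deriv = v.deriv := by
    have hu := u.isWeakDeriv
    rw [h] at hu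
    exact hu.unique v.isWeakDeriv
  apply Subtype.ext
  apply WithLp.ofLp_injective
  exact Prod.ext h h2

/-- A function `u ∈ L_1(I)` belongs to `W^1_1(I)` exactly when it underlies an element of `W11`. -/
theorem W11.exists_toL1_eq_iff (u : L1) : (∃ w : W11, w.toL1 = u) ↔ MemSobolev 1 u := by
  constructor
  · rintro ⟨w, rfl⟩
    exact ⟨w.deriv, w.isWeakDeriv, trivial⟩
  · rintro ⟨g, hg, -⟩
    exact ⟨⟨WithLp.toLp 1 (u, g), hg⟩, rfl⟩

/-- `u` has the boundary value (trace) `c` at the point `a ∈ [0,1]`: `u` agrees almost everywhere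
with a function that is continuous on `[0,1]` and takes the value `c` at `a`. -/
def HasTrace (u : L1) (a : ℝ) (c : ℂ) : Prop :=
  ∃ U : ℝ → ℂ, ContinuousOn U (Icc 0 1) ∧ u =ᵐ[volume.restrict (Ioo (0 : ℝ) 1)] U ∧ U a = c

theorem HasTrace.zero (a : ℝ) : HasTrace 0 a 0 :=
  ⟨0, continuousOn_const, Lp.coeFn_zero ℂ 1 _, rfl⟩

theorem HasTrace.add {u v : L1} {a : ℝ} {c d : ℂ} (hu : HasTrace u a c) (hv : HasTrace v a d) :
    HasTrace (u + v) a (c + d) := by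
  obtain ⟨U, hU, hUe, hUa⟩ := hu
  obtain ⟨V, hV, hVe, hVa⟩ := hv
  refine ⟨U + V, hU.add hV, (Lp.coeFn_add u v).trans (hUe.add hVe), ?_⟩
  simp [hUa, hVa]

theorem HasTrace.smul {u : L1} {a : ℝ} {c : ℂ} (k : ℂ) (hu : HasTrace u a c) :
    HasTrace (k • u) a (k * c) := by
  obtain ⟨U, hU, hUe, hUa⟩ := hu
  refine ⟨k • U, hU.const_smul k, (Lp.coeFn_smul k u).trans (hUe.const_smul k), ?_⟩
  simp [hUa]

theorem HasTrace.add_of_zero {u v : L1} {a : ℝ} (hu : HasTrace u a 0) (hv : HasTrace v a 0) :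
    HasTrace (u + v) a 0 := by
  simpa using hu.add hv

theorem HasTrace.smul_of_zero {u : L1} {a : ℝ} (k : ℂ) (hu : HasTrace u a 0) :
    HasTrace (k • u) a 0 := by
  simpa using hu.smul k

/-! ### The Neumann operator in `W^1_1(I)` -/

/-- The pairs `(u, v)` with `u ∈ W^3_1(I)`, `∂u(0) = ∂u(1) = 0` and `v = ∂∂u`. -/
def neumannGraph : Submodule ℂ (W11 × W11) where
  carrier := {p | (MemSobolev 3 p.1.toL1 ∧ HasTrace p.1.deriv 0 0 ∧ HasTrace p.1.deriv 1 0) ∧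
    IsWeakDeriv p.1.deriv p.2.toL1}
  zero_mem' := ⟨⟨MemSobolev.zero 3, HasTrace.zero 0, HasTrace.zero 1⟩, IsWeakDeriv.zero⟩
  add_mem' h k := ⟨⟨h.1.1.add k.1.1, h.1.2.1.add_of_zero k.1.2.1,
    h.1.2.2.add_of_zero k.1.2.2⟩, h.2.add k.2⟩
  smul_mem' c _ h := ⟨⟨h.1.1.smul c, h.1.2.1.smul_of_zero c,
    h.1.2.2.smul_of_zero c⟩, h.2.smul c⟩

/-- The operator `A^1_0`: the realization of `∂∂` in `W^1_1(I)` with the domain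
`{u ∈ W^3_1(I) : ∂u(0) = ∂u(1) = 0}`. -/
def neumannOp : W11 →ₗ.[ℂ] W11 := neumannGraph.toLinearPMap

theorem graph_neumannOp : neumannOp.graph = neumannGraph := by
  refine Submodule.toLinearPMap_graph_eq _ ?_
  rintro ⟨x, y⟩ hx (hx0 : x = 0)
  subst hx0
  exact W11.ext_toL1 (hx.2.unique IsWeakDeriv.zero)

theorem mem_domain_neumannOp (u : W11) : u ∈ neumannOp.domain ↔
    MemSobolev 3 u.toL1 ∧ HasTrace u.deriv 0 0 ∧ HasTrace u.deriv 1 0 := by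
  rw [LinearPMap.mem_domain_iff, graph_neumannOp]
  constructor
  · rintro ⟨y, hy⟩
    exact hy.1
  · intro h
    obtain ⟨g, hg, g', hg', g'', hg'', -⟩ := h.1
    obtain rfl := hg.unique u.isWeakDeriv
    exact ⟨⟨WithLp.toLp 1 (g', g''), hg''⟩, h, hg'⟩

theorem neumannOp_apply (u : neumannOp.domain) :
    IsWeakDeriv (u : W11).deriv (neumannOp u).toL1 := by
  have h := neumannOp.mem_graph u
  rw [graph_neumannOp] at h
  exact h.2

/-- The sector `Σ_{θ₀} = {l = |l| e^{iθ} : |θ| ≤ θ₀}`. -/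
def closedSector (θ₀ : ℝ) : Set ℂ :=
  {l | ∃ θ : ℝ, |θ| ≤ θ₀ ∧ l = (‖l‖ : ℂ) * Complex.exp (θ * Complex.I)}

end NeumannW11

end

/-! Everything rests on the cosine family C(y)u(x) = (U(x+y) + U(x-y))/2, where U is the even
2-periodic extension of u. It multiplies cos(nπx) by cos(nπy), and it is a contraction for the norm
of W^1_1: U is even, U' is odd, and averaging two translates of such a periodic function does not
increase the L_1 norm over half a period (`integral_norm_average_le`).

Hence an operator whose eigenvalues on the cosine modes are ∫ κ(y) cos(nπy) dμ(y) equals ∫ κ(y) C(y)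
dμ(y) and has norm at most ∫ |κ| dμ (`IsCosineSystem.norm_apply_le`). The Gaussian kernel gives the
heat semigroup in the right half-plane, with the bound √(|z|/Re z). The kernel s⁻¹e^{-sy} on the
half-line gives the resolvent at s², with the bound 1/(|s| Re s). For s² = |l|e^{iθ} with |θ| ≤ θ₀
and Re s > 0 this equals 1/(|l| cos(θ/2)), so the required estimate holds even without the factor 2.

The operators themselves are absolutely convergent series over spectral projections, so identities
between them are checked on cosine coefficients, which determine an element
(`IsCosineSystem.ext_coeff`).

Two facts bring this to W^1_1. Cosine polynomials are dense (`dense_span_cosMode`), because sine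
polynomials are dense in L_1 and integration is bounded from L_1 to W^1_1. The graph of the Neumann
operator consists exactly of the pairs whose coefficients differ by the factors -(nπ)²
(`isDiagonal_neumannOp`); this equivalence identifies the full domain, not merely the action on it.
-/

noncomputable section

namespace NeumannW11

/-! ### Cosine systems in a Banach space -/

section CosineSystem

open scoped Real

variable {X : Type*} [NormedAddCommGroup X] [NormedSpace ℂ X]

/-- A complete biorthogonal system `(e n, c n)` in a Banach space on which the cosine family
`C(y) (e n) = cos (n π y) • e n` acts by contractions. -/
structure IsCosineSystem (e : ℕ → X) (c : ℕ → X →L[ℂ] ℂ) : Prop where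
  biorth : ∀ n m, c n (e m) = if n = m then 1 else 0
  dense : Dense (Submodule.span ℂ (range e) : Set X)
  contraction : ∀ (a : ℕ →₀ ℂ) (y : ℝ),
    ‖a.sum fun n r => ((Real.cos (n * π * y) : ℝ) * r : ℂ) • e n‖ ≤ ‖a.sum fun n r => r • e n‖

theorem integrable_mul_cos {κ : ℝ → ℂ} {μ : Measure ℝ} (hκ : Integrable κ μ) (t : ℝ) :
    Integrable (fun y => κ y * (Real.cos (t * y) : ℝ)) μ := by
  refine hκ.mul_bdd (c := 1) (by fun_prop) (ae_of_all _ fun y => ?_)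
  rw [Complex.norm_real]
  exact Real.abs_cos_le_one _

variable {e : ℕ → X} {c : ℕ → X →L[ℂ] ℂ}

/-- An operator with the eigenvalues `∫ κ(y) cos (n π y) dμ(y)` is bounded by `∫ |κ| dμ`. -/
theorem IsCosineSystem.norm_apply_le [CompleteSpace X] (h : IsCosineSystem e c) {M : X →L[ℂ] X}
    {κ : ℝ → ℂ} {μ : Measure ℝ} (hκ : Integrable κ μ)
    (hM : ∀ n : ℕ, M (e n) = (∫ y, κ y * (Real.cos (n * π * y) : ℝ) ∂μ) • e n) (f : X) :
    ‖M f‖ ≤ (∫ y, ‖κ y‖ ∂μ) * ‖f‖ := by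
  have hcl : IsClosed {f : X | ‖M f‖ ≤ (∫ y, ‖κ y‖ ∂μ) * ‖f‖} :=
    isClosed_le (by fun_prop) (by fun_prop)
  refine hcl.closure_subset_iff.mpr ?_ (h.dense f)
  intro f hf
  obtain ⟨a, rfl⟩ := Finsupp.mem_span_range_iff_exists_finsupp.mp hf
  -- On a finite combination f of modes, M f is the integral of κ(y) C(y) f, and C(y) is a
  -- contraction there.
  have h1 : M (a.sum fun n r => r • e n) =
      ∫ y, κ y • (a.sum fun n r => ((Real.cos (n * π * y) : ℝ) * r : ℂ) • e n) ∂μ := by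
    simp only [Finsupp.sum, map_sum, map_smul, Finset.smul_sum, smul_smul, ← mul_assoc]
    rw [integral_finsetSum _ fun n _ => ((integrable_mul_cos hκ _).mul_const _).smul_const _]
    refine Finset.sum_congr rfl fun n _ => ?_
    rw [integral_smul_const, integral_mul_const, hM, smul_smul, mul_comm]
  rw [mem_ofPred_eq, h1, ← integral_mul_const]
  refine norm_integral_le_of_norm_le (hκ.norm.mul_const _) (ae_of_all _ fun y => ?_)
  rw [norm_smul]
  exact mul_le_mul_of_nonneg_left (h.contraction a y) (norm_nonneg _)

/-- The spectral projection onto the line spanned by `e n`. -/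
def modeProj (e : ℕ → X) (c : ℕ → X →L[ℂ] ℂ) (n : ℕ) : X →L[ℂ] X := (c n).smulRight (e n)

theorem modeProj_apply (n : ℕ) (x : X) : modeProj e c n x = c n x • e n := rfl

theorem integral_cos_mul_cos_nat (n m : ℕ) :
    ∫ y in (0 : ℝ)..1, Real.cos (n * π * y) * Real.cos (m * π * y) =
      if n = m then (if n = 0 then 1 else 1 / 2) else 0 := by
  have key : ∀ k : ℤ, ∫ y in (0 : ℝ)..1, Real.cos (k * π * y) = if k = 0 then 1 else 0 := by
    intro k
    split_ifs with hk
    · simp [hk]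
    · have hk' : (k : ℝ) * π ≠ 0 := mul_ne_zero (by exact_mod_cast hk) Real.pi_ne_zero
      rw [intervalIntegral.integral_comp_mul_left (fun y => Real.cos y) hk', integral_cos]
      simp [Real.sin_int_mul_pi]
  have h : ∀ y : ℝ, Real.cos (n * π * y) * Real.cos (m * π * y) =
      (Real.cos (((n - m : ℤ) : ℝ) * π * y) + Real.cos (((n + m : ℤ) : ℝ) * π * y)) / 2 := by
    intro y
    push_cast
    rw [show ((n : ℝ) - m) * π * y = n * π * y - m * π * y by ring,
      show ((n : ℝ) + m) * π * y = n * π * y + m * π * y by ring, Real.cos_sub, Real.cos_add]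
    ring
  simp_rw [h]
  rw [intervalIntegral.integral_div, intervalIntegral.integral_add
    (Continuous.intervalIntegrable (by fun_prop) _ _)
    (Continuous.intervalIntegrable (by fun_prop) _ _), key, key]
  by_cases hnm : n = m
  · subst hnm
    by_cases hn : n = 0
    · simp [hn]
    · rw [if_pos (by simp), if_neg (by omega)]
      simp [hn]
  · rw [if_neg (by omega), if_neg (by omega), if_neg hnm]
    simp

/-- Orthogonality of the cosines on [0,1] exhibits the projection as the operator with kernel w
cos(nπy), w being the normalization 1 or 2. The uniformity in n makes every absolutely summable
symbol a bounded operator. -/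
theorem IsCosineSystem.norm_modeProj_le [CompleteSpace X] (h : IsCosineSystem e c) (n : ℕ) :
    ‖modeProj e c n‖ ≤ 2 := by
  refine ContinuousLinearMap.opNorm_le_bound _ zero_le_two fun f => ?_
  set w : ℝ := if n = 0 then 1 else 2 with hw
  have hw2 : |w| ≤ 2 := by rw [hw]; split_ifs <;> norm_num
  have hκ : Integrable (fun y : ℝ => ((w * Real.cos (n * π * y) : ℝ) : ℂ))
      (volume.restrict (Ioc 0 1)) := by
    rw [← IntegrableOn, ← intervalIntegrable_iff_integrableOn_Ioc_of_le zero_le_one]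
    exact Continuous.intervalIntegrable (by fun_prop) _ _
  refine (h.norm_apply_le (M := modeProj e c n) hκ (fun m => ?_) f).trans ?_
  · rw [modeProj_apply, h.biorth]
    have h1 : ∫ y in Ioc (0 : ℝ) 1, ((w * Real.cos (n * π * y) : ℝ) : ℂ) *
        (Real.cos (m * π * y) : ℝ) = if n = m then 1 else 0 := by
      rw [← intervalIntegral.integral_of_le zero_le_one]
      simp_rw [← Complex.ofReal_mul, mul_assoc w]
      rw [intervalIntegral.integral_ofReal, intervalIntegral.integral_const_mul,
        integral_cos_mul_cos_nat, hw]
      split_ifs <;> norm_num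
    rw [h1]
    split_ifs with hnm
    · rw [hnm]
    · simp
  · gcongr
    have h2 : ∀ y ∈ Ioc (0 : ℝ) 1, ‖‖((w * Real.cos (n * π * y) : ℝ) : ℂ)‖‖ ≤ 2 := by
      intro y _
      rw [norm_norm, Complex.norm_real, norm_mul]
      calc ‖w‖ * ‖Real.cos (n * π * y)‖ ≤ 2 * 1 :=
            mul_le_mul hw2 (Real.abs_cos_le_one _) (norm_nonneg _) zero_le_two
        _ = 2 := by norm_num
    have := norm_setIntegral_le_of_norm_le_const (μ := volume) (by simp) h2
    simpa using (le_abs_self _).trans this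

/-- The operator with the eigenvalue `m n` on `e n`. -/
def multiplier (e : ℕ → X) (c : ℕ → X →L[ℂ] ℂ) (m : ℕ → ℂ) : X →L[ℂ] X :=
  ∑' n, m n • modeProj e c n

theorem IsCosineSystem.norm_smul_modeProj_le [CompleteSpace X] (h : IsCosineSystem e c)
    (m : ℂ) (n : ℕ) : ‖m • modeProj e c n‖ ≤ ‖m‖ * 2 := by
  rw [norm_smul]
  exact mul_le_mul_of_nonneg_left (h.norm_modeProj_le n) (norm_nonneg _)

theorem IsCosineSystem.hasSum_multiplier [CompleteSpace X] (h : IsCosineSystem e c) {m : ℕ → ℂ}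
    (hm : Summable fun n => ‖m n‖) :
    HasSum (fun n => m n • modeProj e c n) (multiplier e c m) :=
  (Summable.of_norm_bounded (hm.mul_right 2) fun n => h.norm_smul_modeProj_le _ n).hasSum

theorem IsCosineSystem.coeff_multiplier [CompleteSpace X] (h : IsCosineSystem e c) {m : ℕ → ℂ}
    (hm : Summable fun n => ‖m n‖) (k : ℕ) (x : X) :
    c k (multiplier e c m x) = m k * c k x := by
  have h1 := (h.hasSum_multiplier hm).mapL (ContinuousLinearMap.apply ℂ X x)
  have h2 := h1.mapL (c k)
  refine h2.unique ?_
  convert hasSum_ite_eq k (m k * c k x) using 2 with n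
  simp only [ContinuousLinearMap.apply_apply, modeProj_apply,
    map_smul, h.biorth, smul_eq_mul]
  rcases eq_or_ne n k with rfl | hn
  · simp
  · simp [hn, hn.symm]

theorem IsCosineSystem.multiplier_apply_mode [CompleteSpace X] (h : IsCosineSystem e c)
    {m : ℕ → ℂ} (hm : Summable fun n => ‖m n‖) (k : ℕ) :
    multiplier e c m (e k) = m k • e k := by
  have h1 := (h.hasSum_multiplier hm).mapL (ContinuousLinearMap.apply ℂ X (e k))
  refine h1.unique ?_
  convert hasSum_ite_eq k (m k • e k) using 2 with n
  simp only [ContinuousLinearMap.apply_apply, _root_.smul_apply, modeProj_apply,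
    h.biorth]
  rcases eq_or_ne n k with rfl | hn
  · simp
  · simp [hn]

/-! ### The heat semigroup of a cosine system -/

/-- The eigenvalues of the heat semigroup at time `z`. -/
def heatSymbol (z : ℂ) (n : ℕ) : ℂ := Complex.exp (-((n * π : ℝ) : ℂ) ^ 2 * z)

open Classical in
/-- The heat semigroup of a cosine system. -/
def heatSemigroup (e : ℕ → X) (c : ℕ → X →L[ℂ] ℂ) (z : ℂ) : X →L[ℂ] X :=
  if z = 0 then ContinuousLinearMap.id ℂ X else multiplier e c (heatSymbol z)

theorem norm_heatSymbol (z : ℂ) (n : ℕ) : ‖heatSymbol z n‖ = Real.exp (-(n * π) ^ 2 * z.re) := by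
  rw [heatSymbol, Complex.norm_exp, ← Complex.ofReal_pow, ← Complex.ofReal_neg,
    Complex.re_ofReal_mul]

/-- Since n ≤ (nπ)², a geometric sequence dominates the symbol uniformly on a half-plane, which
serves both summability and analyticity. -/
theorem norm_heatSymbol_le {z : ℂ} {a : ℝ} (hz : a ≤ z.re) (ha : 0 ≤ a) (n : ℕ) :
    ‖heatSymbol z n‖ ≤ Real.exp (-a) ^ n := by
  rw [norm_heatSymbol, ← Real.exp_nat_mul, Real.exp_le_exp]
  have h1 : (n : ℝ) ≤ (n * π) ^ 2 := by
    rcases Nat.eq_zero_or_pos n with rfl | hn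
    · simp
    · have h1 : (1 : ℝ) ≤ n := by exact_mod_cast hn
      nlinarith [Real.pi_gt_three, mul_le_mul h1 Real.pi_gt_three.le (by norm_num) (by linarith)]
  have h2 : (n : ℝ) * a ≤ (n * π) ^ 2 * z.re := mul_le_mul h1 hz ha (by positivity)
  linarith

theorem summable_exp_neg_pow {a : ℝ} (ha : 0 < a) : Summable fun n : ℕ => Real.exp (-a) ^ n :=
  summable_geometric_of_lt_one (Real.exp_pos _).le (by rw [Real.exp_lt_one_iff]; linarith)

theorem summable_norm_heatSymbol {z : ℂ} (hz : 0 < z.re) : Summable fun n => ‖heatSymbol z n‖ :=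
  Summable.of_nonneg_of_le (fun _ => norm_nonneg _) (norm_heatSymbol_le le_rfl hz.le)
    (summable_exp_neg_pow hz)

theorem heatSymbol_add (z w : ℂ) (n : ℕ) :
    heatSymbol (z + w) n = heatSymbol z n * heatSymbol w n := by
  rw [heatSymbol, heatSymbol, heatSymbol, ← Complex.exp_add, mul_add]

theorem heatSemigroup_of_re_pos {z : ℂ} (hz : 0 < z.re) :
    heatSemigroup e c z = multiplier e c (heatSymbol z) := by
  rw [heatSemigroup, if_neg]
  rintro rfl
  simp at hz

theorem mem_openSector_pi_div_two {z : ℂ} : z ∈ openSector (π / 2) ↔ 0 < z.re := by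
  rw [openSector, mem_ofPred_eq, Complex.abs_arg_lt_pi_div_two_iff]
  constructor
  · rintro ⟨h0, h | h⟩
    · exact h
    · exact absurd h h0
  · intro h
    refine ⟨?_, Or.inl h⟩
    rintro rfl
    simp at h

theorem isOpen_openSector_pi_div_two : IsOpen (openSector (π / 2)) := by
  have : openSector (π / 2) = {z : ℂ | 0 < z.re} := Set.ext fun _ => mem_openSector_pi_div_two
  rw [this]
  exact isOpen_lt continuous_const Complex.continuous_re

theorem IsCosineSystem.coeff_heatSemigroup [CompleteSpace X] (h : IsCosineSystem e c) {z : ℂ}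
    (hz : 0 < z.re) (n : ℕ) (x : X) : c n (heatSemigroup e c z x) = heatSymbol z n * c n x := by
  rw [heatSemigroup_of_re_pos hz, h.coeff_multiplier (summable_norm_heatSymbol hz)]

theorem IsCosineSystem.heatSemigroup_apply_mode [CompleteSpace X] (h : IsCosineSystem e c) {z : ℂ}
    (hz : 0 < z.re) (n : ℕ) : heatSemigroup e c z (e n) = heatSymbol z n • e n := by
  rw [heatSemigroup_of_re_pos hz, h.multiplier_apply_mode (summable_norm_heatSymbol hz)]

theorem IsCosineSystem.analyticOnNhd_heatSemigroup [CompleteSpace X] (h : IsCosineSystem e c) :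
    AnalyticOnNhd ℂ (heatSemigroup e c) (openSector (π / 2)) := by
  refine DifferentiableOn.analyticOnNhd ?_ isOpen_openSector_pi_div_two
  intro z hz
  rw [mem_openSector_pi_div_two] at hz
  have ha : 0 < z.re / 2 := half_pos hz
  -- On this half-plane the series of entire terms converges normally.
  set U : Set ℂ := {w | z.re / 2 < w.re} with hU
  have hUo : IsOpen U := isOpen_lt continuous_const Complex.continuous_re
  have hzU : z ∈ U := half_lt_self hz
  have hd : DifferentiableOn ℂ (fun w => ∑' n, heatSymbol w n • modeProj e c n) U := by
    refine Complex.differentiableOn_tsum_of_summable_norm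
      ((summable_exp_neg_pow ha).mul_right 2) (fun n => ?_) hUo fun n w hw => ?_
    · unfold heatSymbol
      fun_prop
    · exact (h.norm_smul_modeProj_le _ _).trans
        (mul_le_mul_of_nonneg_right (norm_heatSymbol_le (le_of_lt hw) ha.le n) zero_le_two)
  have hd' : DifferentiableOn ℂ (heatSemigroup e c) U :=
    hd.congr fun w hw => heatSemigroup_of_re_pos (ha.trans hw)
  exact (hd'.differentiableAt (hUo.mem_nhds hzU)).differentiableWithinAt

/-- The heat kernel of the line and its Fourier transform. -/
theorem integral_gaussian_mul_cos {b : ℂ} (hb : 0 < b.re) (t : ℝ) :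
    ∫ y : ℝ, Complex.exp (-b * y ^ 2) * (Real.cos (t * y) : ℝ) =
      (π / b) ^ (1 / 2 : ℂ) * Complex.exp (-(t : ℂ) ^ 2 / (4 * b)) := by
  have hi : ∀ s : ℝ, Integrable fun y : ℝ =>
      Complex.exp (Complex.I * s * y) * Complex.exp (-b * y ^ 2) := by
    intro s
    refine (integrable_cexp_neg_mul_sq hb).bdd_mul (c := 1) (by fun_prop) (ae_of_all _ fun y => ?_)
    rw [show Complex.I * s * y = ((s * y : ℝ) : ℂ) * Complex.I by push_cast; ring,
      Complex.norm_exp_ofReal_mul_I]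
  have h : ∀ y : ℝ, Complex.exp (-b * y ^ 2) * (Real.cos (t * y) : ℝ) =
      (Complex.exp (Complex.I * t * y) * Complex.exp (-b * y ^ 2) +
        Complex.exp (Complex.I * (-t : ℝ) * y) * Complex.exp (-b * y ^ 2)) / 2 := by
    intro y
    rw [Complex.ofReal_cos, Complex.cos]
    push_cast
    rw [show (t : ℂ) * y * Complex.I = Complex.I * t * y by ring,
      show -((t : ℂ) * y) * Complex.I = Complex.I * -t * y by ring]
    ring
  simp_rw [h]
  rw [integral_div, integral_add (hi _) (hi _), fourierIntegral_gaussian hb,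
    fourierIntegral_gaussian hb]
  push_cast
  rw [neg_sq]
  ring

/-- The kernel is the complex heat kernel exp(-by²)/√(π/b) with b = 1/(4z). Its L_1 norm is √(|b|/Re
b) = √(|z|/Re z). -/
theorem IsCosineSystem.norm_heatSemigroup_apply_le [CompleteSpace X] (h : IsCosineSystem e c)
    {z : ℂ} (hz : 0 < z.re) (f : X) : ‖heatSemigroup e c z f‖ ≤ √(‖z‖ / z.re) * ‖f‖ := by
  have hz0 : z ≠ 0 := by
    rintro rfl
    simp at hz
  set b : ℂ := (4 * z)⁻¹ with hb
  have hb0 : b ≠ 0 := inv_ne_zero (mul_ne_zero (by norm_num) hz0)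
  have hbn : ‖b‖ = 1 / (4 * ‖z‖) := by rw [hb]; simp
  have hbre : b.re = z.re / (4 * ‖z‖ ^ 2) := by
    rw [hb, Complex.inv_re, ← Complex.sq_norm, Complex.norm_mul]
    have : ‖z‖ ≠ 0 := norm_ne_zero_iff.mpr hz0
    simp
    field_simp
  have hzn : 0 < ‖z‖ := norm_pos_iff.mpr hz0
  have hbpos : 0 < b.re := by rw [hbre]; positivity
  have hπb : (π / b : ℂ) ≠ 0 := div_ne_zero (by exact_mod_cast Real.pi_ne_zero) hb0
  set k : ℂ := ((π / b : ℂ) ^ (1 / 2 : ℂ)) with hk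
  have hkn : ‖k‖ = √(π / ‖b‖) := by
    rw [hk, Complex.norm_cpow_of_ne_zero hπb]
    simp [Real.sqrt_eq_rpow, abs_of_pos Real.pi_pos]
  have hk0 : k ≠ 0 := by
    rw [← norm_ne_zero_iff, hkn]
    have := Real.pi_pos
    have := norm_pos_iff.mpr hb0
    positivity
  have hκ : Integrable fun y : ℝ => k⁻¹ * Complex.exp (-b * y ^ 2) :=
    (integrable_cexp_neg_mul_sq hbpos).const_mul _
  refine (h.norm_apply_le (M := heatSemigroup e c z) hκ (fun n => ?_) f).trans (le_of_eq ?_)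
  · rw [h.heatSemigroup_apply_mode hz]
    congr 1
    simp_rw [mul_assoc k⁻¹]
    rw [integral_const_mul, integral_gaussian_mul_cos hbpos, ← hk, inv_mul_cancel_left₀ hk0,
      heatSymbol, hb]
    congr 1
    field_simp
  · congr 1
    simp_rw [norm_mul, norm_cexp_neg_mul_sq, norm_inv]
    rw [integral_const_mul, integral_gaussian, hkn, ← Real.sqrt_inv, ← Real.sqrt_mul (by positivity)]
    congr 1
    rw [hbn, hbre]
    have := Real.pi_ne_zero
    field_simp

theorem IsCosineSystem.norm_heatSemigroup_apply_le_of_mem_openSector [CompleteSpace X]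
    (h : IsCosineSystem e c) {δ : ℝ} (hδ : δ < π / 2) {z : ℂ} (hz : z ∈ openSector δ)
    (f : X) : ‖heatSemigroup e c z f‖ ≤ √(1 / Real.cos δ) * ‖f‖ := by
  have hzre : 0 < z.re := mem_openSector_pi_div_two.mp ⟨hz.1, hz.2.trans hδ⟩
  refine (h.norm_heatSemigroup_apply_le hzre f).trans ?_
  have hzn : 0 < ‖z‖ := norm_pos_iff.mpr hz.1
  have hδ0 : 0 < δ := (abs_nonneg _).trans_lt hz.2
  have hc : 0 < Real.cos δ := Real.cos_pos_of_mem_Ioo ⟨by linarith, hδ⟩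
  refine mul_le_mul_of_nonneg_right (Real.sqrt_le_sqrt ?_) (norm_nonneg f)
  rw [div_le_div_iff₀ hzre hc, one_mul, ← Complex.norm_mul_cos_arg z]
  refine mul_le_mul_of_nonneg_left ?_ hzn.le
  rw [← Real.cos_abs z.arg]
  exact Real.cos_le_cos_of_nonneg_of_le_pi (abs_nonneg _) (by linarith [Real.pi_pos]) hz.2.le

/-- Convergence is clear on finite combinations of modes; density and the uniform bound on the
sector extend it to all of `X`. -/
theorem IsCosineSystem.tendsto_heatSemigroup [CompleteSpace X] (h : IsCosineSystem e c) {δ : ℝ}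
    (hδ : δ < π / 2) (x : X) :
    Tendsto (fun z => heatSemigroup e c z x) (𝓝[openSector δ] 0) (𝓝 x) := by
  have hmem : ∀ᶠ z in 𝓝[openSector δ] (0 : ℂ), z ∈ openSector δ := self_mem_nhdsWithin
  have hspan : ∀ x ∈ Submodule.span ℂ (range e),
      Tendsto (fun z => heatSemigroup e c z x) (𝓝[openSector δ] 0) (𝓝 x) := by
    intro x hx
    induction hx using Submodule.span_induction with
    | mem x hx =>
      obtain ⟨n, rfl⟩ := hx
      have h1 : Tendsto (fun z => heatSymbol z n • e n) (𝓝 0) (𝓝 (e n)) := by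
        have : Continuous fun z => heatSymbol z n • e n := by unfold heatSymbol; fun_prop
        simpa [heatSymbol] using this.tendsto 0
      refine (h1.mono_left nhdsWithin_le_nhds).congr' ?_
      filter_upwards [hmem] with z hz
      rw [h.heatSemigroup_apply_mode (mem_openSector_pi_div_two.mp ⟨hz.1, hz.2.trans hδ⟩)]
    | zero => simpa using tendsto_const_nhds
    | add x y _ _ hx hy => simpa using hx.add hy
    | smul r x _ hx => simpa using hx.const_smul r
  rw [Metric.tendsto_nhds]
  intro ε hε
  set M := √(1 / Real.cos δ)
  have hM : 0 ≤ M := Real.sqrt_nonneg _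
  obtain ⟨x', hx', hd⟩ := h.dense.exists_dist_lt x (ε := ε / (2 * (M + 1))) (by positivity)
  filter_upwards [hmem, (Metric.tendsto_nhds.mp (hspan x' hx')) (ε / 2) (half_pos hε)] with z hz hz2
  have h1 : dist (heatSemigroup e c z x) (heatSemigroup e c z x') ≤ M * dist x x' := by
    rw [dist_eq_norm, dist_eq_norm, ← map_sub]
    exact h.norm_heatSemigroup_apply_le_of_mem_openSector hδ hz _
  have h2 : (M + 1) * dist x x' < ε / 2 := by
    rw [lt_div_iff₀ (by positivity)] at hd
    linarith
  calc dist (heatSemigroup e c z x) x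
      ≤ dist (heatSemigroup e c z x) (heatSemigroup e c z x') +
        dist (heatSemigroup e c z x') x' + dist x' x := dist_triangle4 _ _ _ _
    _ < ε := by rw [dist_comm x' x]; linarith

theorem ofReal_mem_openSector {δ : ℝ} (hδ : 0 < δ) {t : ℝ} (ht : 0 < t) :
    (t : ℂ) ∈ openSector δ :=
  ⟨by exact_mod_cast ht.ne', by rwa [Complex.arg_ofReal_of_nonneg ht.le, abs_zero]⟩

theorem tendsto_ofReal_nhdsWithin_openSector {δ : ℝ} (hδ : 0 < δ) :
    Tendsto (fun t : ℝ => (t : ℂ)) (𝓝[>] 0) (𝓝[openSector δ] 0) := by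
  refine tendsto_nhdsWithin_iff.mpr ⟨?_, ?_⟩
  · exact (by simpa using Complex.continuous_ofReal.tendsto 0 :
      Tendsto (fun t : ℝ => (t : ℂ)) (𝓝 0) (𝓝 0)).mono_left nhdsWithin_le_nhds
  · filter_upwards [self_mem_nhdsWithin] with t ht
    exact ofReal_mem_openSector hδ ht

theorem IsCosineSystem.tendsto_heatSemigroup_ofReal [CompleteSpace X] (h : IsCosineSystem e c)
    (x : X) : Tendsto (fun t : ℝ => heatSemigroup e c t x) (𝓝[>] 0) (𝓝 x) :=
  (h.tendsto_heatSemigroup (δ := π / 4) (by linarith [Real.pi_pos]) x).comp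
    (tendsto_ofReal_nhdsWithin_openSector (by positivity))

/-- An element is determined by its coefficients. -/
theorem IsCosineSystem.ext_coeff [CompleteSpace X] (h : IsCosineSystem e c) {x y : X}
    (hxy : ∀ n, c n x = c n y) : x = y := by
  -- For t > 0 the series for T(t)x involves only the coefficients of x, and T(t)x tends to x.
  refine tendsto_nhds_unique (h.tendsto_heatSemigroup_ofReal x)
    ((h.tendsto_heatSemigroup_ofReal y).congr' ?_)
  filter_upwards [self_mem_nhdsWithin] with t ht
  have ht' : 0 < (t : ℂ).re := ht
  rw [heatSemigroup_of_re_pos ht']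
  have h1 := (h.hasSum_multiplier (summable_norm_heatSymbol ht')).mapL
    (ContinuousLinearMap.apply ℂ X x)
  have h2 := (h.hasSum_multiplier (summable_norm_heatSymbol ht')).mapL
    (ContinuousLinearMap.apply ℂ X y)
  refine h2.unique (h1.congr_fun fun n => ?_)
  simp [modeProj_apply, hxy]

theorem IsCosineSystem.isAnalyticSemigroup [CompleteSpace X] (h : IsCosineSystem e c) :
    IsAnalyticSemigroup (π / 2) (heatSemigroup e c) where
  map_zero := if_pos rfl
  map_add z hz w hw := by
    rw [mem_openSector_pi_div_two] at hz hw
    have hzw : 0 < (z + w).re := add_pos hz hw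
    ext x
    refine h.ext_coeff fun n => ?_
    rw [ContinuousLinearMap.comp_apply, h.coeff_heatSemigroup hzw, h.coeff_heatSemigroup hz,
      h.coeff_heatSemigroup hw, heatSymbol_add, mul_assoc]
  analytic := h.analyticOnNhd_heatSemigroup
  tendsto_zero _ _ hδ x := h.tendsto_heatSemigroup hδ x

/-- The operator `A` acts on the coefficients as multiplication by `-(n π)²`. -/
def IsDiagonal (c : ℕ → X →L[ℂ] ℂ) (A : X →ₗ.[ℂ] X) : Prop :=
  ∀ x y : X, (x, y) ∈ A.graph ↔ ∀ n, c n y = -((n * π : ℝ) : ℂ) ^ 2 * c n x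

theorem hasDerivAt_heatSymbol (z : ℂ) (n : ℕ) : HasDerivAt (fun z => heatSymbol z n)
    (-((n * π : ℝ) : ℂ) ^ 2 * heatSymbol z n) z := by
  have := ((hasDerivAt_id z).const_mul (-((n * π : ℝ) : ℂ) ^ 2)).cexp
  simpa [heatSymbol, mul_comm] using this

theorem IsCosineSystem.hasDerivAt_heatSemigroup_ofReal [CompleteSpace X] (h : IsCosineSystem e c)
    {x y : X} (hxy : ∀ n, c n y = -((n * π : ℝ) : ℂ) ^ 2 * c n x) {t : ℝ} (ht : 0 < t) :
    HasDerivAt (fun t : ℝ => heatSemigroup e c t x) (heatSemigroup e c t y) t := by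
  have ht' : 0 < (t : ℂ).re := ht
  have htm : (t : ℂ) ∈ openSector (π / 2) := mem_openSector_pi_div_two.mpr ht'
  have hd : HasDerivAt (fun z => heatSemigroup e c z x) (deriv (heatSemigroup e c) t x) (t : ℂ) :=
    ((ContinuousLinearMap.apply ℂ X x).hasFDerivAt.comp_hasDerivAt (t : ℂ)
      (h.analyticOnNhd_heatSemigroup t htm).differentiableAt.hasDerivAt)
  -- Analyticity gives a derivative in norm; its value is then read off from the coefficients.
  have heq : deriv (heatSemigroup e c) t x = heatSemigroup e c t y := by
    refine h.ext_coeff fun n => ?_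
    have h1 := (c n).hasFDerivAt.comp_hasDerivAt (t : ℂ) hd
    have h2 : HasDerivAt (fun z => c n (heatSemigroup e c z x))
        (-((n * π : ℝ) : ℂ) ^ 2 * heatSymbol t n * c n x) (t : ℂ) := by
      refine ((hasDerivAt_heatSymbol t n).mul_const (c n x)).congr_of_eventuallyEq ?_
      filter_upwards [isOpen_openSector_pi_div_two.mem_nhds htm] with z hz
      exact h.coeff_heatSemigroup (mem_openSector_pi_div_two.mp hz) n x
    rw [h.coeff_heatSemigroup ht', hxy]
    refine (h1.unique h2).trans ?_
    ring
  rw [← heq]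
  simpa [Function.comp_def] using hd.scomp t Complex.ofRealCLM.hasDerivAt

theorem IsCosineSystem.isGenerator [CompleteSpace X] (h : IsCosineSystem e c) {A : X →ₗ.[ℂ] X}
    (hA : IsDiagonal c A) : IsGenerator A (heatSemigroup e c) := by
  intro x y
  rw [hA]
  have hT0 : ∀ x, heatSemigroup e c ((0 : ℝ) : ℂ) x = x := fun x => by simp [heatSemigroup]
  constructor
  · intro hxy
    -- The orbit t ↦ T(t)x is continuous at 0 and its derivative T(t)y tends to y, so y is also the
    -- right derivative at 0.
    have hder := hasDerivWithinAt_Ici_of_tendsto_deriv (s := Ioi (0 : ℝ)) (a := 0) (e := y)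
      (f := fun t : ℝ => heatSemigroup e c t x)
      (fun t ht => (h.hasDerivAt_heatSemigroup_ofReal hxy ht).differentiableAt.differentiableWithinAt)
      (by
        rw [ContinuousWithinAt, hT0]
        exact h.tendsto_heatSemigroup_ofReal x)
      self_mem_nhdsWithin
      ((h.tendsto_heatSemigroup_ofReal y).congr' (by
        filter_upwards [self_mem_nhdsWithin] with t ht
        exact (h.hasDerivAt_heatSemigroup_ofReal hxy ht).deriv.symm))
    have := (hasDerivWithinAt_iff_tendsto_slope' (by simp)).mp hder.Ioi_of_Ici
    refine this.congr fun t => ?_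
    rw [slope_def_module, hT0, sub_zero, ← Complex.ofReal_inv, Complex.coe_smul]
  · intro hlim n
    -- Conversely, apply a coefficient functional to the difference quotient and differentiate the
    -- scalar symbol at 0.
    have h1 := ((c n).continuous.tendsto y).comp hlim
    have h2 : HasDerivAt (fun t : ℝ => heatSymbol t n * c n x)
        (-((n * π : ℝ) : ℂ) ^ 2 * heatSymbol (0 : ℝ) n * c n x) 0 :=
      ((hasDerivAt_heatSymbol ((0 : ℝ) : ℂ) n).mul_const (c n x)).comp_ofReal
    have h3 := (hasDerivWithinAt_iff_tendsto_slope' (s := Ioi (0 : ℝ)) (by simp)).mp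
      h2.hasDerivWithinAt
    have h4 : heatSymbol (0 : ℝ) n = 1 := by simp [heatSymbol]
    rw [h4, mul_one] at h3
    refine tendsto_nhds_unique h1 (h3.congr' ?_)
    filter_upwards [self_mem_nhdsWithin] with t ht
    have ht' : 0 < (t : ℂ).re := ht
    rw [slope_def_module, h4, sub_zero, Function.comp_apply, map_smul, map_sub,
      h.coeff_heatSemigroup ht', one_mul, ← Complex.ofReal_inv, Complex.coe_smul]

theorem IsCosineSystem.generatesAnalyticSemigroup [CompleteSpace X] (h : IsCosineSystem e c)
    {A : X →ₗ.[ℂ] X} (hA : IsDiagonal c A) : GeneratesAnalyticSemigroup A :=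
  ⟨π / 2, by positivity, le_rfl, heatSemigroup e c, h.isAnalyticSemigroup, h.isGenerator hA⟩

/-! ### The resolvent -/

/-- For n > |l| one has |l + (nπ)²| ≥ 9n² - n ≥ n². Only finitely many terms escape this, including
any with vanishing denominator. -/
theorem summable_norm_resolventSymbol (l : ℂ) :
    Summable fun n : ℕ => ‖(l + ((n * π : ℝ) : ℂ) ^ 2)⁻¹‖ := by
  refine Summable.of_norm_bounded_eventually_nat (g := fun n : ℕ => 1 / (n : ℝ) ^ 2)
    (Real.summable_one_div_nat_pow.mpr one_lt_two) ?_
  filter_upwards [eventually_ge_atTop (⌈‖l‖⌉₊ + 1)] with n hn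
  have hn1 : (1 : ℝ) ≤ n := by exact_mod_cast (Nat.le_add_left 1 _).trans hn
  have hnl : ‖l‖ ≤ n := (Nat.le_ceil _).trans (by exact_mod_cast (Nat.le_succ _).trans hn)
  rw [norm_norm, norm_inv, ← one_div]
  refine one_div_le_one_div_of_le (by positivity) ?_
  have h1 : ‖((n * π : ℝ) : ℂ) ^ 2‖ = (n * π) ^ 2 := by
    rw [norm_pow, Complex.norm_real, Real.norm_eq_abs, sq_abs]
  have h2 : ‖((n * π : ℝ) : ℂ) ^ 2‖ ≤ ‖l + ((n * π : ℝ) : ℂ) ^ 2‖ + ‖l‖ := by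
    have := norm_sub_le (l + ((n * π : ℝ) : ℂ) ^ 2) l
    rwa [add_sub_cancel_left] at this
  have h3 : (n : ℝ) ^ 2 * 9 ≤ (n * π) ^ 2 := by
    rw [mul_pow]
    gcongr
    nlinarith [Real.pi_gt_three]
  nlinarith

theorem sq_add_sq_ne_zero {s : ℂ} (hs : 0 < s.re) (t : ℝ) : s ^ 2 + (t : ℂ) ^ 2 ≠ 0 := by
  have h : s ^ 2 + (t : ℂ) ^ 2 = (s + t * Complex.I) * (s - t * Complex.I) := by
    linear_combination (t : ℂ) ^ 2 * Complex.I_sq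
  rw [h]
  refine mul_ne_zero ?_ ?_ <;>
  · intro h0
    have := congrArg Complex.re h0
    simp at this
    linarith

/-- This Laplace transform of the cosine expresses the resolvent at s² as s⁻¹ ∫ e^{-sy} C(y) dy over
the half-line. -/
theorem integral_exp_mul_cos {s : ℂ} (hs : 0 < s.re) (t : ℝ) :
    ∫ y in Ioi (0 : ℝ), Complex.exp (-s * y) * (Real.cos (t * y) : ℝ) =
      s * (s ^ 2 + (t : ℂ) ^ 2)⁻¹ := by
  have h : ∀ y : ℝ, Complex.exp (-s * y) * (Real.cos (t * y) : ℝ) =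
      (Complex.exp ((-s + t * Complex.I) * y) + Complex.exp ((-s - t * Complex.I) * y)) / 2 := by
    intro y
    rw [Complex.ofReal_cos, Complex.cos, mul_div_assoc', mul_add, ← Complex.exp_add,
      ← Complex.exp_add]
    push_cast
    ring_nf
  have h1 : (-s + t * Complex.I).re < 0 := by simpa using hs
  have h2 : (-s - t * Complex.I).re < 0 := by simpa using hs
  simp_rw [h]
  rw [integral_div, integral_add (integrableOn_exp_mul_complex_Ioi h1 0)
    (integrableOn_exp_mul_complex_Ioi h2 0), integral_exp_mul_complex_Ioi h1,
    integral_exp_mul_complex_Ioi h2]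
  have h10 : -s + t * Complex.I ≠ 0 := fun h0 => by rw [h0] at h1; simp at h1
  have h20 : -s - t * Complex.I ≠ 0 := fun h0 => by rw [h0] at h2; simp at h2
  have h30 := sq_add_sq_ne_zero hs t
  simp only [Complex.ofReal_zero, mul_zero, Complex.exp_zero]
  field_simp
  linear_combination (2 * s * (t : ℂ) ^ 2) * Complex.I_sq

theorem IsCosineSystem.isResolventAt [CompleteSpace X] (h : IsCosineSystem e c) {A : X →ₗ.[ℂ] X}
    (hA : IsDiagonal c A) {s : ℂ} (hs : 0 < s.re) :
    IsResolventAt A (s ^ 2)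
      (multiplier e c fun n => (s ^ 2 + ((n * π : ℝ) : ℂ) ^ 2)⁻¹) := by
  have hc := h.coeff_multiplier (summable_norm_resolventSymbol (s ^ 2))
  set R := multiplier e c fun n => (s ^ 2 + ((n * π : ℝ) : ℂ) ^ 2)⁻¹
  refine ⟨fun f => ?_, fun u => ?_⟩
  · have hg : (R f, s ^ 2 • R f - f) ∈ A.graph := by
      refine (hA _ _).mpr fun n => ?_
      rw [map_sub, map_smul, hc, smul_eq_mul]
      have := sq_add_sq_ne_zero hs (n * π)
      field_simp
      ring
    obtain ⟨⟨y, hm⟩, hy : y = R f, hv⟩ := (LinearPMap.mem_graph_iff A).mp hg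
    subst hy
    exact ⟨hm, by rw [hv]; exact sub_sub_cancel _ _⟩
  · refine h.ext_coeff fun n => ?_
    have h1 := (hA _ _).mp (A.mem_graph u) n
    rw [hc, map_sub, map_smul, h1, smul_eq_mul]
    have := sq_add_sq_ne_zero hs (n * π)
    field_simp
    ring

/-- The constant is the L_1 norm of the kernel s⁻¹e^{-sy} on the half-line. -/
theorem IsCosineSystem.norm_resolvent_le [CompleteSpace X] (h : IsCosineSystem e c)
    {s : ℂ} (hs : 0 < s.re) (f : X) :
    ‖multiplier e c (fun n => (s ^ 2 + ((n * π : ℝ) : ℂ) ^ 2)⁻¹) f‖ ≤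
      (‖s‖ * s.re)⁻¹ * ‖f‖ := by
  have hs0 : s ≠ 0 := by
    rintro rfl
    simp at hs
  have hκ : Integrable (fun y : ℝ => s⁻¹ * Complex.exp (-s * y)) (volume.restrict (Ioi 0)) :=
    (integrableOn_exp_mul_complex_Ioi (a := -s) (by simpa using hs) 0).const_mul _
  refine (h.norm_apply_le hκ (fun n => ?_) f).trans (le_of_eq ?_)
  · rw [h.multiplier_apply_mode (summable_norm_resolventSymbol (s ^ 2))]
    congr 1
    simp_rw [mul_assoc s⁻¹]
    rw [integral_const_mul, integral_exp_mul_cos hs, inv_mul_cancel_left₀ hs0]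
  · congr 1
    have hn : ∀ y : ℝ, ‖s⁻¹ * Complex.exp (-s * y)‖ = ‖s‖⁻¹ * Real.exp (-s.re * y) := by
      intro y
      rw [norm_mul, norm_inv, Complex.norm_exp, Complex.re_mul_ofReal, Complex.neg_re]
    simp_rw [hn]
    rw [integral_const_mul, integral_exp_mul_Ioi (by linarith)]
    simp [mul_comm]

theorem IsCosineSystem.resolvent_estimate [CompleteSpace X] (h : IsCosineSystem e c)
    {A : X →ₗ.[ℂ] X} (hA : IsDiagonal c A) {θ₀ : ℝ} (hθ₀ : θ₀ < π) {l : ℂ}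
    (hl : l ∈ closedSector θ₀) (hl0 : l ≠ 0) :
    l ∈ resolventSet A ∧ ∀ f : X, ‖resolvent A l f‖ ≤ ‖f‖ / (‖l‖ * Real.cos (θ₀ / 2)) := by
  obtain ⟨θ, hθ, hlθ⟩ := hl
  have hθ₀' : 0 ≤ θ₀ := (abs_nonneg _).trans hθ
  have hln : 0 < ‖l‖ := norm_pos_iff.mpr hl0
  -- This square root of l has positive real part because |θ/2| < π/2, and |s| Re s = |l| cos(θ/2).
  set s : ℂ := (√‖l‖ : ℝ) * Complex.exp ((θ / 2 : ℝ) * Complex.I) with hs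
  have hsq : s ^ 2 = l := by
    rw [hs, mul_pow, ← Complex.exp_nat_mul, ← Complex.ofReal_pow, Real.sq_sqrt hln.le]
    conv_rhs => rw [hlθ]
    congr 2
    push_cast
    ring
  have hsn : ‖s‖ = √‖l‖ := by
    rw [hs, norm_mul, Complex.norm_exp_ofReal_mul_I, mul_one, Complex.norm_real,
      Real.norm_of_nonneg (Real.sqrt_nonneg _)]
  have hsre : s.re = √‖l‖ * Real.cos (θ / 2) := by
    rw [hs, Complex.re_ofReal_mul, Complex.exp_ofReal_mul_I_re]
  have hcos0 : 0 < Real.cos (θ₀ / 2) :=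
    Real.cos_pos_of_mem_Ioo ⟨by linarith [Real.pi_pos], by linarith⟩
  have hcos : Real.cos (θ₀ / 2) ≤ Real.cos (θ / 2) := by
    rw [← Real.cos_abs (θ / 2), abs_div, abs_two]
    exact Real.cos_le_cos_of_nonneg_of_le_pi (by positivity) (by linarith) (by linarith)
  have hspos : 0 < s.re := by
    rw [hsre]
    exact mul_pos (Real.sqrt_pos.mpr hln) (hcos0.trans_le hcos)
  have hR := h.isResolventAt hA hspos
  rw [hsq] at hR
  refine ⟨⟨_, hR⟩, fun f => ?_⟩
  rw [← hR.eq_resolvent, ← hsq]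
  refine (h.norm_resolvent_le hspos f).trans ?_
  rw [hsq, hsn, hsre, ← mul_assoc, Real.mul_self_sqrt hln.le, inv_mul_eq_div]
  gcongr

end CosineSystem

/-! ### The space `W^1_1(I)` -/

section Sobolev

open scoped Real

theorem integrable_Ioo_of_continuous {E : Type*} [NormedAddCommGroup E] {F : ℝ → E}
    (hF : Continuous F) : Integrable F (volume.restrict (Ioo (0 : ℝ) 1)) :=
  (hF.integrableOn_Icc (a := 0) (b := 1)).mono_set Ioo_subset_Icc_self

theorem exists_bound_Ioo {E : Type*} [NormedAddCommGroup E] {F : ℝ → E} (hF : Continuous F) :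
    ∃ C, ∀ᵐ x ∂(volume.restrict (Ioo (0 : ℝ) 1)), ‖F x‖ ≤ C := by
  obtain ⟨C, hC⟩ := isCompact_Icc.exists_bound_of_continuousOn (s := Icc (0 : ℝ) 1) hF.continuousOn
  refine ⟨C, ?_⟩
  filter_upwards [ae_restrict_mem measurableSet_Ioo] with x hx
  exact hC x (Ioo_subset_Icc_self hx)

theorem integrable_continuous_smul {φ : ℝ → ℝ} (hφ : Continuous φ) (u : L1) :
    Integrable (fun x => φ x • u x) (volume.restrict (Ioo (0 : ℝ) 1)) := by
  obtain ⟨C, hC⟩ := exists_bound_Ioo hφ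
  exact (L1.integrable_coeFn u).bdd_smul C hφ.aestronglyMeasurable hC

/-- The functional `u ↦ ∫ φ u` on `L_1(I)`, for a continuous function `φ`. -/
def pairing (φ : ℝ → ℝ) (hφ : Continuous φ) : L1 →L[ℂ] ℂ :=
  LinearMap.mkContinuousOfExistsBound
    { toFun := fun u => ∫ x in Ioo (0 : ℝ) 1, φ x • u x
      map_add' := fun u v => by
        rw [← integral_add (integrable_continuous_smul hφ u) (integrable_continuous_smul hφ v)]
        refine integral_congr_ae ?_
        filter_upwards [Lp.coeFn_add u v] with x hx
        rw [hx, Pi.add_apply, smul_add]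
      map_smul' := fun c u => by
        rw [RingHom.id_apply, ← integral_smul]
        refine integral_congr_ae ?_
        filter_upwards [Lp.coeFn_smul c u] with x hx
        rw [hx, Pi.smul_apply, smul_comm] }
    (by
      obtain ⟨C, hC⟩ := exists_bound_Ioo hφ
      refine ⟨C, fun u => ?_⟩
      rw [L1.norm_eq_integral_norm, ← integral_const_mul]
      refine norm_integral_le_of_norm_le ((L1.integrable_coeFn u).norm.const_mul C) ?_
      filter_upwards [hC] with x hx
      rw [norm_smul]
      exact mul_le_mul_of_nonneg_right hx (norm_nonneg _))

theorem pairing_apply {φ : ℝ → ℝ} (hφ : Continuous φ) (u : L1) :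
    pairing φ hφ u = ∫ x in Ioo (0 : ℝ) 1, φ x • u x := rfl

/-- Each test function imposes an equation between continuous functionals; completeness of `W11`
follows. -/
theorem isClosed_W11Submodule : IsClosed (W11Submodule : Set (WithLp 1 (L1 × L1))) := by
  have h1 : Continuous fun p : WithLp 1 (L1 × L1) => p.fst :=
    continuous_fst.comp (WithLp.prod_continuous_ofLp 1 L1 L1)
  have h2 : Continuous fun p : WithLp 1 (L1 × L1) => p.snd :=
    continuous_snd.comp (WithLp.prod_continuous_ofLp 1 L1 L1)
  have h : (W11Submodule : Set (WithLp 1 (L1 × L1))) =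
      ⋂ (φ : ℝ → ℝ) (hφ : ContDiff ℝ ∞ φ) (_ : HasCompactSupport φ)
        (_ : tsupport φ ⊆ Ioo (0 : ℝ) 1),
        {p | pairing (_root_.deriv φ) (hφ.continuous_deriv (by simp)) p.fst =
          -pairing φ hφ.continuous p.snd} := by
    ext p
    simp only [mem_iInter]
    rfl
  rw [h]
  refine isClosed_iInter fun φ => isClosed_iInter fun hφ => isClosed_iInter fun _ =>
    isClosed_iInter fun _ => isClosed_eq ?_ ?_
  · exact (ContinuousLinearMap.continuous _).comp h1
  · exact ((ContinuousLinearMap.continuous _).comp h2).neg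

instance completeSpace_W11 : CompleteSpace W11 :=
  isClosed_W11Submodule.completeSpace_coe

/-- The inclusion of `W^1_1(I)` in `L_1(I)`. -/
def W11.toL1L : W11 →L[ℂ] L1 :=
  LinearMap.mkContinuous
    { toFun := W11.toL1
      map_add' := fun _ _ => rfl
      map_smul' := fun _ _ => rfl } 1 fun u => by
      rw [one_mul, W11.norm_eq]
      exact le_add_of_nonneg_right (norm_nonneg _)

/-! ### Primitives, integration by parts and absolutely continuous representatives -/

/-- The primitive of `g ∈ L_1(I)` that vanishes at `0`. -/
def primitive (g : L1) (x : ℝ) : ℂ := ∫ y in (0 : ℝ)..x, (Ioo (0 : ℝ) 1).indicator g y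

theorem integrable_indicator_Ioo (g : L1) : Integrable ((Ioo (0 : ℝ) 1).indicator g) :=
  (integrable_indicator_iff measurableSet_Ioo).mpr (L1.integrable_coeFn g)

theorem continuous_primitive (g : L1) : Continuous (primitive g) :=
  intervalIntegral.continuous_primitive
    (fun _ _ => (integrable_indicator_Ioo g).intervalIntegrable) 0

theorem primitive_zero (g : L1) : primitive g 0 = 0 := intervalIntegral.integral_same

theorem primitive_eq {g : L1} {x : ℝ} (hx : 0 ≤ x) :
    primitive g x = ∫ y in Ioo (0 : ℝ) 1, (Iic x).indicator g y := by
  rw [primitive, intervalIntegral.integral_of_le hx, setIntegral_indicator measurableSet_Ioo,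
    setIntegral_indicator measurableSet_Iic]
  congr 2
  ext y
  simp only [mem_inter_iff, mem_Ioc, mem_Ioo, mem_Iic]
  tauto

theorem primitive_one (g : L1) : primitive g 1 = ∫ y in Ioo (0 : ℝ) 1, g y := by
  rw [primitive_eq (zero_le_one' ℝ)]
  refine setIntegral_congr_fun measurableSet_Ioo fun y hy => ?_
  exact indicator_of_mem (s := Iic (1 : ℝ)) hy.2.le g

theorem norm_primitive_le (g : L1) {x : ℝ} (hx : 0 ≤ x) : ‖primitive g x‖ ≤ ‖g‖ := by
  rw [primitive_eq hx, L1.norm_eq_integral_norm]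
  refine norm_integral_le_of_norm_le (L1.integrable_coeFn g).norm (ae_of_all _ fun y => ?_)
  exact norm_indicator_le_norm_self _ _

/-- Integration by parts. -/
theorem integral_deriv_smul_primitive {φ φ' : ℝ → ℝ} (hφ : ∀ x, HasDerivAt φ (φ' x) x)
    (hφ' : Continuous φ') (g : L1) :
    ∫ x in Ioo (0 : ℝ) 1, φ' x • primitive g x =
      φ 1 • primitive g 1 - ∫ x in Ioo (0 : ℝ) 1, φ x • g x := by
  have hφc : Continuous φ := continuous_iff_continuousAt.mpr fun x => (hφ x).continuousAt
  set μ := volume.restrict (Ioo (0 : ℝ) 1) with hμ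
  -- Fubini on the triangle y ≤ x: the inner integral of φ' over [y,1] is φ(1) - φ(y).
  set T : Set (ℝ × ℝ) := {p | p.2 ≤ p.1} with hT
  have hTm : MeasurableSet T := measurableSet_le measurable_snd measurable_fst
  have hint : Integrable (T.indicator fun p : ℝ × ℝ => φ' p.1 • g p.2) (μ.prod μ) :=
    ((integrable_Ioo_of_continuous hφ').smul_prod (L1.integrable_coeFn g)).indicator hTm
  have hleft : ∫ x, φ' x • primitive g x ∂μ =
      ∫ x, ∫ y, T.indicator (fun p : ℝ × ℝ => φ' p.1 • g p.2) (x, y) ∂μ ∂μ := by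
    refine setIntegral_congr_fun measurableSet_Ioo fun x hx => ?_
    rw [primitive_eq hx.1.le, ← integral_smul]
    refine integral_congr_ae (ae_of_all _ fun y => ?_)
    by_cases hy : y ≤ x
    · simp [hT, hy, indicator]
    · simp [hT, hy, indicator]
  have hright : ∀ y ∈ Ioo (0 : ℝ) 1,
      ∫ x, T.indicator (fun p : ℝ × ℝ => φ' p.1 • g p.2) (x, y) ∂μ = (φ 1 - φ y) • g y := by
    intro y hy
    rw [← intervalIntegral.integral_eq_sub_of_hasDerivAt (fun x _ => hφ x)
      (hφ'.intervalIntegrable y 1), intervalIntegral.integral_of_le hy.2.le,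
      ← integral_Icc_eq_integral_Ioc, ← integral_smul_const]
    have h1 : ∀ x, T.indicator (fun p : ℝ × ℝ => φ' p.1 • g p.2) (x, y) =
        (Ici y).indicator (fun x => φ' x • g y) x := by
      intro x
      by_cases hx : y ≤ x
      · simp [hT, hx, indicator]
      · simp [hT, hx, indicator]
    simp_rw [h1]
    rw [hμ, setIntegral_indicator measurableSet_Ici, integral_Icc_eq_integral_Ico]
    congr 2
    ext x
    simp only [mem_inter_iff, mem_Ioo, mem_Ici, mem_Ico]
    constructor
    · rintro ⟨⟨_, h⟩, h'⟩
      exact ⟨h', h⟩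
    · rintro ⟨h, h'⟩
      exact ⟨⟨hy.1.trans_le h, h'⟩, h⟩
  rw [hleft, integral_integral_swap
    (f := fun x y => T.indicator (fun p : ℝ × ℝ => φ' p.1 • g p.2) (x, y)) hint,
    setIntegral_congr_fun measurableSet_Ioo hright]
  simp_rw [sub_smul]
  have hi : Integrable (fun x => φ 1 • g x) μ := (L1.integrable_coeFn g).smul (φ 1)
  rw [integral_sub hi (integrable_continuous_smul hφc g), integral_smul, primitive_one]

/-- The element of `L_1(I)` given by a continuous function. -/
def contToL1 (F : ℝ → ℂ) (hF : Continuous F) : L1 := (integrable_Ioo_of_continuous hF).toL1 F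

theorem coeFn_contToL1 {F : ℝ → ℂ} (hF : Continuous F) :
    contToL1 F hF =ᵐ[volume.restrict (Ioo (0 : ℝ) 1)] F :=
  Integrable.coeFn_toL1 _

theorem norm_contToL1 {F : ℝ → ℂ} (hF : Continuous F) :
    ‖contToL1 F hF‖ = ∫ x in Ioo (0 : ℝ) 1, ‖F x‖ := by
  rw [L1.norm_eq_integral_norm]
  refine integral_congr_ae ?_
  filter_upwards [coeFn_contToL1 hF] with x hx
  rw [hx]

/-- In the integration by parts the boundary term vanishes with the test function, and the constant
drops out because φ' has integral 0. -/
theorem isWeakDeriv_primitive {u g : L1} (a : ℂ)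
    (hu : u =ᵐ[volume.restrict (Ioo (0 : ℝ) 1)] fun x => a + primitive g x) :
    IsWeakDeriv u g := by
  intro φ hφ hc hs
  have hφd : ∀ x, HasDerivAt φ (_root_.deriv φ x) x := fun x =>
    (hφ.differentiable (by simp) x).hasDerivAt
  have hφ'c : Continuous (_root_.deriv φ) := hφ.continuous_deriv (by simp)
  have hend : ∀ x, x ∉ Ioo (0 : ℝ) 1 → φ x = 0 := fun x hx =>
    image_eq_zero_of_notMem_tsupport fun h => hx (hs h)
  have h1 : ∫ x in Ioo (0 : ℝ) 1, _root_.deriv φ x • u x =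
      ∫ x in Ioo (0 : ℝ) 1, (_root_.deriv φ x • a + _root_.deriv φ x • primitive g x) := by
    refine integral_congr_ae ?_
    filter_upwards [hu] with x hx
    rw [hx, smul_add]
  have h2 : ∫ x in Ioo (0 : ℝ) 1, _root_.deriv φ x = 0 := by
    rw [← integral_Ioc_eq_integral_Ioo, ← intervalIntegral.integral_of_le zero_le_one,
      intervalIntegral.integral_eq_sub_of_hasDerivAt (fun x _ => hφd x)
      (hφ'c.intervalIntegrable _ _), hend 1 (by simp), hend 0 (by simp), sub_zero]
  have hi : Integrable (fun x => _root_.deriv φ x • primitive g x)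
      (volume.restrict (Ioo (0 : ℝ) 1)) :=
    integrable_Ioo_of_continuous (hφ'c.smul (continuous_primitive g))
  rw [h1, integral_add (integrable_Ioo_of_continuous (by fun_prop)) hi, integral_smul_const, h2,
    integral_deriv_smul_primitive hφd hφ'c, hend 1 (by simp)]
  simp

theorem primitive_add (g₁ g₂ : L1) {x : ℝ} (hx : 0 ≤ x) :
    primitive (g₁ + g₂) x = primitive g₁ x + primitive g₂ x := by
  rw [primitive_eq hx, primitive_eq hx, primitive_eq hx, ← integral_add
    ((L1.integrable_coeFn g₁).indicator measurableSet_Iic)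
    ((L1.integrable_coeFn g₂).indicator measurableSet_Iic)]
  refine integral_congr_ae ?_
  filter_upwards [Lp.coeFn_add g₁ g₂] with y hy
  by_cases h : y ∈ Iic x
  · simp only [indicator_of_mem h, hy, Pi.add_apply]
  · simp only [indicator_of_notMem h, add_zero]

theorem primitive_smul (r : ℂ) (g : L1) {x : ℝ} (hx : 0 ≤ x) :
    primitive (r • g) x = r • primitive g x := by
  rw [primitive_eq hx, primitive_eq hx, ← integral_smul]
  refine integral_congr_ae ?_
  filter_upwards [Lp.coeFn_smul r g] with y hy
  by_cases h : y ∈ Iic x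
  · simp only [indicator_of_mem h, hy, Pi.smul_apply]
  · simp only [indicator_of_notMem h, smul_zero]

/-- The integration operator `g ↦ ∫_0^x g` from `L_1(I)` to `W^1_1(I)`. -/
def integration : L1 →L[ℂ] W11 :=
  LinearMap.mkContinuous
    { toFun := fun g => ⟨WithLp.toLp 1 (contToL1 (primitive g) (continuous_primitive g), g),
        isWeakDeriv_primitive 0 (by simpa using coeFn_contToL1 (continuous_primitive g))⟩
      map_add' := fun g₁ g₂ => by
        refine W11.ext_toL1 (Lp.ext ?_)
        refine (coeFn_contToL1 (continuous_primitive _)).trans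
          (EventuallyEq.trans ?_ (Lp.coeFn_add _ _).symm)
        filter_upwards [coeFn_contToL1 (continuous_primitive g₁),
          coeFn_contToL1 (continuous_primitive g₂), ae_restrict_mem measurableSet_Ioo]
          with x h1 h2 hx
        rw [Pi.add_apply, primitive_add _ _ hx.1.le]
        exact (congrArg₂ (· + ·) h1 h2).symm
      map_smul' := fun r g => by
        refine W11.ext_toL1 (Lp.ext ?_)
        refine (coeFn_contToL1 (continuous_primitive _)).trans
          (EventuallyEq.trans ?_ (Lp.coeFn_smul _ _).symm)
        filter_upwards [coeFn_contToL1 (continuous_primitive g),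
          ae_restrict_mem measurableSet_Ioo] with x h1 hx
        rw [Pi.smul_apply, primitive_smul _ _ hx.1.le]
        exact (congrArg (r • ·) h1).symm } 2 fun g => by
      rw [W11.norm_eq, two_mul]
      refine add_le_add ?_ le_rfl
      change ‖contToL1 (primitive g) (continuous_primitive g)‖ ≤ ‖g‖
      rw [norm_contToL1]
      have := norm_setIntegral_le_of_norm_le_const (μ := volume) (s := Ioo (0 : ℝ) 1)
        (f := fun x => ‖primitive g x‖) (by simp)
        fun x hx => by simpa using norm_primitive_le g hx.1.le
      simpa using (le_abs_self _).trans this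

theorem toL1_integration (g : L1) :
    (integration g).toL1 =ᵐ[volume.restrict (Ioo (0 : ℝ) 1)] primitive g :=
  coeFn_contToL1 (continuous_primitive g)

/-- A smooth function with compact support in `]0,1[` and mean zero is the derivative of a smooth
function with compact support in `]0,1[`. -/
theorem exists_primitive_of_integral_eq_zero {χ : ℝ → ℝ} (hχ : ContDiff ℝ ∞ χ)
    (hc : HasCompactSupport χ) (hs : tsupport χ ⊆ Ioo (0 : ℝ) 1)
    (h0 : ∫ x in Ioo (0 : ℝ) 1, χ x = 0) :
    ∃ Φ : ℝ → ℝ, ContDiff ℝ ∞ Φ ∧ HasCompactSupport Φ ∧ tsupport Φ ⊆ Ioo (0 : ℝ) 1 ∧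
      _root_.deriv Φ = χ := by
  -- The added point keeps the set nonempty when χ = 0, so that its least and greatest elements
  -- exist.
  have hK : IsCompact (tsupport χ ∪ {1 / 2}) := hc.isCompact.union isCompact_singleton
  have hKn : (tsupport χ ∪ {1 / 2}).Nonempty := ⟨1 / 2, Or.inr rfl⟩
  have hKs : tsupport χ ∪ {1 / 2} ⊆ Ioo (0 : ℝ) 1 :=
    union_subset hs (singleton_subset_iff.mpr ⟨by norm_num, by norm_num⟩)
  obtain ⟨α, hα, hαl⟩ := hK.exists_isLeast hKn
  obtain ⟨β, hβ, hβl⟩ := hK.exists_isGreatest hKn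
  have hz : ∀ x, x ∉ Icc α β → χ x = 0 := fun x hx =>
    image_eq_zero_of_notMem_tsupport fun h => hx ⟨hαl (Or.inl h), hβl (Or.inl h)⟩
  have hder : ∀ x, HasDerivAt (fun x => ∫ y in (0 : ℝ)..x, χ y) (χ x) x := fun x =>
    hχ.continuous.integral_hasStrictDerivAt 0 x |>.hasDerivAt
  have hderiv : _root_.deriv (fun x => ∫ y in (0 : ℝ)..x, χ y) = χ := funext fun x => (hder x).deriv
  have hα0 : 0 < α := (hKs hα).1
  have hβ1 : β < 1 := (hKs hβ).2
  have hsub : tsupport (fun x => ∫ y in (0 : ℝ)..x, χ y) ⊆ Icc α β := by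
    refine closure_minimal ?_ isClosed_Icc
    rw [Function.support_subset_iff']
    intro x hx
    rcases lt_or_ge x α with h | h
    · rw [intervalIntegral.integral_congr (g := fun _ => 0) fun y hy => hz y fun hy' => ?_]
      · simp
      · rcases uIcc_subset_Icc (a₂ := min 0 x) (b₂ := max 0 x) (by simp) (by simp) hy with ⟨_, h2⟩
        have := max_lt hα0 h
        linarith [hy'.1]
    · have hβx : β < x := lt_of_not_ge fun h' => hx ⟨h, h'⟩
      have h1 : ∫ y in (1 : ℝ)..x, χ y = 0 := by
        rw [intervalIntegral.integral_congr (g := fun _ => 0) fun y hy => hz y fun hy' => ?_]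
        · simp
        · rcases uIcc_subset_Icc (a₂ := min 1 x) (b₂ := max 1 x) (by simp) (by simp) hy with ⟨h2, _⟩
          have := lt_min hβ1 hβx
          linarith [hy'.2]
      rw [← intervalIntegral.integral_add_adjacent_intervals (b := 1)
        (hχ.continuous.intervalIntegrable _ _) (hχ.continuous.intervalIntegrable _ _), h1,
        intervalIntegral.integral_of_le zero_le_one, integral_Ioc_eq_integral_Ioo, h0, add_zero]
  refine ⟨fun x => ∫ y in (0 : ℝ)..x, χ y, ?_, ?_, hsub.trans fun x hx =>
    ⟨hα0.trans_le hx.1, hx.2.trans_lt hβ1⟩, hderiv⟩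
  · rw [contDiff_infty_iff_deriv, hderiv]
    exact ⟨fun x => (hder x).differentiableAt, hχ⟩
  · exact isCompact_Icc.of_isClosed_subset (isClosed_tsupport _) hsub

/-- An element of `L_1(I)` with vanishing weak derivative is constant. -/
theorem IsWeakDeriv.ae_eq_const {u : L1} (hu : IsWeakDeriv u 0) :
    ∃ a : ℂ, u =ᵐ[volume.restrict (Ioo (0 : ℝ) 1)] fun _ => a := by
  obtain ⟨ψ₀, hs₀, hc₀, hψ₀, hr₀, h1₀⟩ := exists_contDiff_tsupport_subset (n := ⊤)
    (isOpen_Ioo.mem_nhds (show (1 / 2 : ℝ) ∈ Ioo (0 : ℝ) 1 by norm_num))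
  have hψ₀c : Continuous ψ₀ := hψ₀.continuous
  set m : ℝ := ∫ x in Ioo (0 : ℝ) 1, ψ₀ x with hm
  have hm0 : 0 < m := by
    rw [hm, setIntegral_eq_integral_of_forall_compl_eq_zero fun x hx =>
      image_eq_zero_of_notMem_tsupport fun h => hx (hs₀ h)]
    refine hψ₀c.integral_pos_of_hasCompactSupport_nonneg_nonzero hc₀
      (fun x => (hr₀ ⟨x, rfl⟩).1) (x := 1 / 2) (by rw [h1₀]; exact one_ne_zero)
  -- The constant is the mean of u with respect to the fixed bump ψ₀. Any test function minus a
  -- suitable multiple of ψ₀ has mean zero, hence is the derivative of a test function and is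
  -- annihilated by u.
  refine ⟨(m⁻¹ : ℝ) • ∫ x in Ioo (0 : ℝ) 1, ψ₀ x • u x, ?_⟩
  set a : ℂ := (m⁻¹ : ℝ) • ∫ x in Ioo (0 : ℝ) 1, ψ₀ x • u x with ha
  have hui := L1.integrable_coeFn u
  have hz : ∀ᵐ x ∂(volume.restrict (Ioo (0 : ℝ) 1)), x ∈ Ioo (0 : ℝ) 1 → u x - a = 0 := by
    refine isOpen_Ioo.ae_eq_zero_of_integral_contDiff_smul_eq_zero
      ((hui.sub (integrable_const a)).locallyIntegrable.locallyIntegrableOn _) ?_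
    intro ψ hψ hc hs
    have hψc : Continuous ψ := hψ.continuous
    set k : ℝ := (∫ x in Ioo (0 : ℝ) 1, ψ x) * m⁻¹ with hk
    obtain ⟨Φ, hΦ, hΦc, hΦs, hΦd⟩ := exists_primitive_of_integral_eq_zero
      (χ := fun x => ψ x - k * ψ₀ x) (hψ.sub (contDiff_const.mul hψ₀))
      (hc.sub (hc₀.mul_left (f := fun _ => k)))
      ((tsupport_sub ψ _).trans (union_subset hs ((tsupport_mul_subset_right).trans hs₀))) (by
        rw [integral_sub (integrable_Ioo_of_continuous hψc)
          (integrable_Ioo_of_continuous (hψ₀c.const_mul k)), integral_const_mul, ← hm, hk,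
          mul_assoc, inv_mul_cancel₀ hm0.ne', mul_one, sub_self])
    have h := hu Φ hΦ hΦc hΦs
    have hr : ∫ x in Ioo (0 : ℝ) 1, Φ x • (0 : L1) x = 0 := by
      rw [← pairing_apply hΦ.continuous, map_zero]
    rw [hΦd, hr, neg_zero] at h
    simp_rw [sub_smul, mul_smul] at h
    have hi : Integrable (fun x => k • ψ₀ x • u x) (volume.restrict (Ioo (0 : ℝ) 1)) :=
      (integrable_continuous_smul hψ₀c u).smul k
    rw [integral_sub (integrable_continuous_smul hψc u) hi, integral_smul, sub_eq_zero] at h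
    simp_rw [smul_sub]
    rw [integral_sub (integrable_continuous_smul hψc u)
      ((integrable_Ioo_of_continuous hψc).smul_const a), integral_smul_const, h, ha, hk,
      mul_smul, sub_self]
  filter_upwards [hz, ae_restrict_mem measurableSet_Ioo] with x hx hm
  exact sub_eq_zero.mp (hx hm)

theorem primitive_contToL1 {F : ℝ → ℂ} (hF : Continuous F) {x : ℝ} (hx : x ∈ Icc (0 : ℝ) 1) :
    primitive (contToL1 F hF) x = ∫ y in (0 : ℝ)..x, F y := by
  rw [primitive_eq hx.1, intervalIntegral.integral_of_le hx.1]
  have h : ∫ y in Ioo (0 : ℝ) 1, (Iic x).indicator (contToL1 F hF) y =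
      ∫ y in Ioo (0 : ℝ) 1, (Iic x).indicator F y := by
    refine integral_congr_ae ?_
    filter_upwards [coeFn_contToL1 hF] with y hy
    by_cases h : y ∈ Iic x
    · simp only [indicator_of_mem h, hy]
    · simp only [indicator_of_notMem h]
  rw [h, ← integral_Ioc_eq_integral_Ioo, setIntegral_indicator measurableSet_Iic, Ioc_inter_Iic,
    min_eq_right hx.2]

/-- The element `w` of `W^1_1(I)` is represented by the function `F` with derivative `F'`. -/
structure W11.IsRep (w : W11) (F F' : ℝ → ℂ) : Prop where
  toL1 : w.toL1 =ᵐ[volume.restrict (Ioo (0 : ℝ) 1)] F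
  deriv : w.deriv =ᵐ[volume.restrict (Ioo (0 : ℝ) 1)] F'

theorem W11.IsRep.smul {w : W11} {F F' : ℝ → ℂ} (r : ℂ) (h : w.IsRep F F') :
    (r • w).IsRep (fun x => r * F x) (fun x => r * F' x) where
  toL1 := (Lp.coeFn_smul r _).trans (h.toL1.const_smul r)
  deriv := (Lp.coeFn_smul r _).trans (h.deriv.const_smul r)

theorem W11.IsRep.sum {ι : Type*} (s : Finset ι) {w : ι → W11} {F F' : ι → ℝ → ℂ}
    (h : ∀ i, (w i).IsRep (F i) (F' i)) :
    (∑ i ∈ s, w i).IsRep (fun x => ∑ i ∈ s, F i x) (fun x => ∑ i ∈ s, F' i x) := by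
  classical
  induction s using Finset.induction_on with
  | empty => exact ⟨Lp.coeFn_zero ℂ 1 _, Lp.coeFn_zero ℂ 1 _⟩
  | insert i s hi ih =>
    simp only [Finset.sum_insert hi]
    exact ⟨(Lp.coeFn_add _ _).trans ((h i).toL1.add ih.toL1),
      (Lp.coeFn_add _ _).trans ((h i).deriv.add ih.deriv)⟩

theorem W11.IsRep.norm_eq {w : W11} {F F' : ℝ → ℂ} (h : w.IsRep F F') :
    ‖w‖ = (∫ x in Ioo (0 : ℝ) 1, ‖F x‖) + ∫ x in Ioo (0 : ℝ) 1, ‖F' x‖ := by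
  rw [W11.norm_eq, L1.norm_eq_integral_norm, L1.norm_eq_integral_norm]
  congr 1
  · exact integral_congr_ae (h.toL1.fun_comp norm)
  · exact integral_congr_ae (h.deriv.fun_comp norm)

/-! ### Cosine modes and cosine coefficients -/

theorem hasDerivAt_cos_mode (n : ℕ) (x : ℝ) :
    HasDerivAt (fun x : ℝ => Real.cos (n * π * x)) (-(n * π) * Real.sin (n * π * x)) x := by
  have := ((hasDerivAt_id x).const_mul (n * π : ℝ)).cos
  simpa [mul_comm] using this

theorem hasDerivAt_sin_mode (n : ℕ) (x : ℝ) :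
    HasDerivAt (fun x : ℝ => Real.sin (n * π * x)) (n * π * Real.cos (n * π * x)) x := by
  have := ((hasDerivAt_id x).const_mul (n * π : ℝ)).sin
  simpa [mul_comm] using this

theorem continuous_cos_mode (n : ℕ) :
    Continuous fun x : ℝ => ((Real.cos (n * π * x) : ℝ) : ℂ) := by fun_prop

theorem continuous_sin_mode (n : ℕ) :
    Continuous fun x : ℝ => ((Real.sin (n * π * x) : ℝ) : ℂ) := by fun_prop

theorem continuous_deriv_cos_mode (n : ℕ) :
    Continuous fun x : ℝ => ((-(n * π) * Real.sin (n * π * x) : ℝ) : ℂ) := by fun_prop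

/-- The element `cos (n π x)` of `W^1_1(I)`. -/
def cosMode (n : ℕ) : W11 :=
  ⟨WithLp.toLp 1 (contToL1 _ (continuous_cos_mode n), contToL1 _ (continuous_deriv_cos_mode n)), by
    refine isWeakDeriv_primitive 1 ?_
    filter_upwards [coeFn_contToL1 (continuous_cos_mode n), ae_restrict_mem measurableSet_Ioo]
      with x hx hxm
    change contToL1 _ (continuous_cos_mode n) x =
      1 + primitive (contToL1 _ (continuous_deriv_cos_mode n)) x
    rw [hx, primitive_contToL1 _ (Ioo_subset_Icc_self hxm), intervalIntegral.integral_ofReal,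
      intervalIntegral.integral_eq_sub_of_hasDerivAt (fun y _ => hasDerivAt_cos_mode n y)
      (Continuous.intervalIntegrable (by fun_prop) _ _)]
    simp⟩

theorem isRep_cosMode (n : ℕ) : (cosMode n).IsRep (fun x => (Real.cos (n * π * x) : ℝ))
    (fun x => (-(n * π) * Real.sin (n * π * x) : ℝ)) :=
  ⟨coeFn_contToL1 (continuous_cos_mode n), coeFn_contToL1 (continuous_deriv_cos_mode n)⟩

theorem deriv_cosMode_zero : (cosMode 0).deriv = 0 := by
  refine Lp.ext ((isRep_cosMode 0).deriv.trans ?_)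
  filter_upwards [Lp.coeFn_zero ℂ 1 (volume.restrict (Ioo (0 : ℝ) 1))] with x hx
  rw [hx]
  simp

/-- Every element of `W^1_1(I)` is a constant plus the primitive of its derivative. -/
theorem W11.exists_eq_const_add (w : W11) :
    ∃ a : ℂ, w = a • cosMode 0 + integration w.deriv := by
  have h : IsWeakDeriv (w - integration w.deriv).toL1 0 := by
    have := (w - integration w.deriv).isWeakDeriv
    have h0 : (w - integration w.deriv).deriv = 0 := sub_self w.deriv
    rwa [h0] at this
  obtain ⟨a, ha⟩ := h.ae_eq_const
  refine ⟨a, sub_eq_iff_eq_add.mp (W11.ext_toL1 (Lp.ext (ha.trans ?_)))⟩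
  filter_upwards [((isRep_cosMode 0).smul a).toL1] with x hx
  rw [hx]
  simp

/-- The cosine coefficients of an element of `W^1_1(I)`. -/
def cosCoeff (n : ℕ) : W11 →L[ℂ] ℂ :=
  (if n = 0 then 1 else 2 : ℂ) •
    (pairing (fun x => Real.cos (n * π * x)) (by fun_prop)).comp W11.toL1L

theorem cosCoeff_apply (n : ℕ) (w : W11) : cosCoeff n w = (if n = 0 then 1 else 2 : ℂ) *
    ∫ x in Ioo (0 : ℝ) 1, Real.cos (n * π * x) • w.toL1 x := rfl

theorem cosCoeff_cosMode (n m : ℕ) : cosCoeff n (cosMode m) = if n = m then 1 else 0 := by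
  have h : ∫ x in Ioo (0 : ℝ) 1, Real.cos (n * π * x) • (cosMode m).toL1 x =
      ((∫ x in (0 : ℝ)..1, Real.cos (n * π * x) * Real.cos (m * π * x) : ℝ) : ℂ) := by
    rw [← intervalIntegral.integral_ofReal, intervalIntegral.integral_of_le zero_le_one,
      integral_Ioc_eq_integral_Ioo]
    refine integral_congr_ae ?_
    filter_upwards [(isRep_cosMode m).toL1] with x hx
    rw [hx, Complex.real_smul, Complex.ofReal_mul]
  rw [cosCoeff_apply, h, integral_cos_mul_cos_nat]
  split_ifs <;> simp

/-! ### Contractivity of the cosine family -/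

/-- After the triangle inequality, the reflection x ↦ -x moves the second translate to [-1,0]. Both
together integrate |H(· + y)| over a full period, which does not depend on y. Only |H| has to be
even, so odd functions are covered too. -/
theorem integral_norm_average_le {H : ℝ → ℂ} (hH : Continuous H)
    (hper : Function.Periodic H 2) (heven : ∀ x, ‖H (-x)‖ = ‖H x‖) (y : ℝ) :
    ∫ x in Ioo (0 : ℝ) 1, ‖(H (x + y) + H (x - y)) / 2‖ ≤ ∫ x in Ioo (0 : ℝ) 1, ‖H x‖ := by
  simp_rw [← integral_Ioc_eq_integral_Ioo, ← intervalIntegral.integral_of_le (zero_le_one' ℝ)]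
  have hi : ∀ {G : ℝ → ℝ}, Continuous G → ∀ a b, IntervalIntegrable G volume a b :=
    fun h a b => h.intervalIntegrable a b
  have hN : Continuous fun x => ‖H x‖ := hH.norm
  have hNper : Function.Periodic (fun x => ‖H x‖) 2 := fun x => congrArg norm (hper x)
  have h1 : ∫ x in (0 : ℝ)..1, ‖H (x - y)‖ = ∫ x in (-1 : ℝ)..0, ‖H (x + y)‖ := by
    have h2 : ∀ x : ℝ, ‖H (x - y)‖ = ‖H (-x + y)‖ := fun x => by
      rw [← heven (x - y)]
      congr 2
      ring
    simp_rw [h2]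
    rw [intervalIntegral.integral_comp_neg (fun x => ‖H (x + y)‖), neg_zero]
  have h3 : ∫ x in (-1 : ℝ)..0, ‖H x‖ = ∫ x in (0 : ℝ)..1, ‖H x‖ := by
    have := intervalIntegral.integral_comp_neg (fun x => ‖H x‖) (a := 0) (b := 1)
    simp only [heven, neg_zero] at this
    exact this.symm
  have h4 : (∫ x in (-1 : ℝ)..0, ‖H (x + y)‖) + ∫ x in (0 : ℝ)..1, ‖H (x + y)‖ =
      2 * ∫ x in (0 : ℝ)..1, ‖H x‖ := by
    rw [intervalIntegral.integral_add_adjacent_intervals (hi (by fun_prop) _ _)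
      (hi (by fun_prop) _ _), intervalIntegral.integral_comp_add_right (fun x => ‖H x‖),
      show (1 : ℝ) + y = (-1 + y) + 2 by ring, hNper.intervalIntegral_add_eq (-1 + y) (-1),
      show (-1 : ℝ) + 2 = 1 by norm_num, ← intervalIntegral.integral_add_adjacent_intervals
      (hi hN (-1) 0) (hi hN 0 1), h3]
    ring
  calc ∫ x in (0 : ℝ)..1, ‖(H (x + y) + H (x - y)) / 2‖
      ≤ ∫ x in (0 : ℝ)..1, (‖H (x + y)‖ + ‖H (x - y)‖) / 2 := by
        refine intervalIntegral.integral_mono_on zero_le_one (hi (by fun_prop) _ _)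
          (hi (by fun_prop) _ _) fun x _ => ?_
        rw [norm_div, Complex.norm_two]
        gcongr
        exact norm_add_le _ _
    _ = ∫ x in (0 : ℝ)..1, ‖H x‖ := by
        rw [intervalIntegral.integral_div, intervalIntegral.integral_add (hi (by fun_prop) _ _)
          (hi (by fun_prop) _ _), h1]
        linarith

/-- By the addition formulas, multiplying the coefficients by cos(nπy) averages the translates by ±y
both of the even function F and of its odd derivative G; the two parts of the norm are bounded
separately. -/
theorem norm_cosine_family_le (a : ℕ →₀ ℂ) (y : ℝ) :
    ‖a.sum fun n r => ((Real.cos (n * π * y) : ℝ) * r : ℂ) • cosMode n‖ ≤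
      ‖a.sum fun n r => r • cosMode n‖ := by
  simp only [Finsupp.sum]
  set F : ℝ → ℂ := fun x => ∑ n ∈ a.support, a n * (Real.cos (n * π * x) : ℝ) with hF
  set G : ℝ → ℂ := fun x => ∑ n ∈ a.support, a n * (-(n * π) * Real.sin (n * π * x) : ℝ) with hG
  have hper : ∀ (n : ℕ) (x : ℝ), (n : ℝ) * π * (x + 2) = n * π * x + n * (2 * π) :=
    fun n x => by ring
  have hFper : Function.Periodic F 2 := fun x => by
    simp only [hF, hper, Real.cos_add_nat_mul_two_pi]
  have hGper : Function.Periodic G 2 := fun x => by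
    simp only [hG, hper, Real.sin_add_nat_mul_two_pi]
  have hFeven : ∀ x, ‖F (-x)‖ = ‖F x‖ := fun x => by
    simp only [hF, mul_neg, Real.cos_neg]
  have hGodd : ∀ x, ‖G (-x)‖ = ‖G x‖ := fun x => by
    rw [← norm_neg (G x)]
    simp only [hG, mul_neg, Real.sin_neg, Complex.ofReal_neg, Finset.sum_neg_distrib]
  have h1 := W11.IsRep.sum a.support fun n => (isRep_cosMode n).smul (a n)
  have h2 := W11.IsRep.sum a.support fun n =>
    (isRep_cosMode n).smul ((Real.cos (n * π * y) : ℝ) * a n)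
  rw [h1.norm_eq, h2.norm_eq]
  refine add_le_add ?_ ?_
  · refine le_of_eq_of_le ?_ (integral_norm_average_le (by fun_prop) hFper hFeven y)
    congr 1
    ext x
    congr 1
    simp only [hF]
    rw [← Finset.sum_add_distrib, Finset.sum_div]
    refine Finset.sum_congr rfl fun n _ => ?_
    rw [mul_add, mul_sub, Real.cos_add, Real.cos_sub]
    push_cast
    ring
  · refine le_of_eq_of_le ?_ (integral_norm_average_le (by fun_prop) hGper hGodd y)
    congr 1
    ext x
    congr 1
    simp only [hG]
    rw [← Finset.sum_add_distrib, Finset.sum_div]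
    refine Finset.sum_congr rfl fun n _ => ?_
    rw [mul_add (_ * π), mul_sub (_ * π), Real.sin_add, Real.sin_sub]
    push_cast
    ring

/-! ### Density of the cosine polynomials -/

/-- The trigonometric sine polynomials. -/
def sinePolynomials : Submodule ℂ (ℝ → ℂ) :=
  Submodule.span ℂ (range fun (n : ℕ) (x : ℝ) => ((Real.sin (n * π * x) : ℝ) : ℂ))

theorem sin_mem_sinePolynomials (n : ℕ) :
    (fun x : ℝ => ((Real.sin (n * π * x) : ℝ) : ℂ)) ∈ sinePolynomials :=
  Submodule.subset_span ⟨n, rfl⟩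

/-- Uses 2 cos(πx) sin((n+1)πx) = sin((n+2)πx) + sin(nπx). -/
theorem cos_mul_mem_sinePolynomials {F : ℝ → ℂ} (hF : F ∈ sinePolynomials) :
    (fun x => ((Real.cos (π * x) : ℝ) : ℂ) * F x) ∈ sinePolynomials := by
  induction hF using Submodule.span_induction with
  | mem F hF =>
    obtain ⟨n, rfl⟩ := hF
    rcases n with _ | n
    · convert sinePolynomials.zero_mem using 1
      ext x
      simp
    · have := sinePolynomials.smul_mem (1 / 2 : ℂ) (sinePolynomials.add_mem
        (sin_mem_sinePolynomials (n + 2)) (sin_mem_sinePolynomials n))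
      convert this using 1
      ext x
      have h1 : ((n + 2 : ℕ) : ℝ) * π * x = (n + 1 : ℕ) * π * x + π * x := by push_cast; ring
      have h2 : (n : ℝ) * π * x = (n + 1 : ℕ) * π * x - π * x := by push_cast; ring
      simp only [Pi.smul_apply, Pi.add_apply, smul_eq_mul]
      rw [h1, h2, Real.sin_add, Real.sin_sub]
      simp only [Complex.ofReal_add, Complex.ofReal_sub, Complex.ofReal_mul]
      ring
  | zero =>
    convert sinePolynomials.zero_mem using 1
    ext x
    simp
  | add F G _ _ hF hG =>
    convert sinePolynomials.add_mem hF hG using 1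
    ext x
    simp [mul_add]
  | smul r F _ hF =>
    convert sinePolynomials.smul_mem r hF using 1
    ext x
    simp [mul_left_comm]

theorem polynomial_mul_sin_mem_sinePolynomials (p : Polynomial ℝ) :
    (fun x => ((p.eval (Real.cos (π * x)) * Real.sin (π * x) : ℝ) : ℂ)) ∈ sinePolynomials := by
  have hmon : ∀ m : ℕ, (fun x => ((Real.cos (π * x) ^ m * Real.sin (π * x) : ℝ) : ℂ)) ∈
      sinePolynomials := by
    intro m
    induction m with
    | zero => simpa using sin_mem_sinePolynomials 1
    | succ m ih =>
      convert cos_mul_mem_sinePolynomials ih using 1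
      ext x
      push_cast
      ring
  induction p using Polynomial.induction_on' with
  | add p q hp hq =>
    convert sinePolynomials.add_mem hp hq using 1
    ext x
    simp [add_mul]
  | monomial m r =>
    convert sinePolynomials.smul_mem (r : ℂ) (hmon m) using 1
    ext x
    simp [mul_assoc]

theorem contToL1_add {F G : ℝ → ℂ} (hF : Continuous F) (hG : Continuous G) :
    contToL1 (F + G) (hF.add hG) = contToL1 F hF + contToL1 G hG := rfl

theorem contToL1_smul {F : ℝ → ℂ} (r : ℂ) (hF : Continuous F) :
    contToL1 (r • F) (hF.const_smul r) = r • contToL1 F hF := rfl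

/-- The closed span of the functions `sin (n π x)` in `L_1(I)`. -/
def sineClosure : Submodule ℂ L1 :=
  (Submodule.span ℂ (range fun n : ℕ =>
    contToL1 _ (continuous_sin_mode n))).topologicalClosure

theorem contToL1_mem_sineClosure {F : ℝ → ℂ} (hF : F ∈ sinePolynomials) :
    ∃ hc : Continuous F, contToL1 F hc ∈ sineClosure := by
  induction hF using Submodule.span_induction with
  | mem F hF =>
    obtain ⟨n, rfl⟩ := hF
    exact ⟨by fun_prop, Submodule.le_topologicalClosure _ (Submodule.subset_span ⟨n, rfl⟩)⟩
  | zero => exact ⟨continuous_zero, sineClosure.zero_mem⟩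
  | add F G _ _ hF hG => exact ⟨hF.1.add hG.1, sineClosure.add_mem hF.2 hG.2⟩
  | smul r F _ hF => exact ⟨hF.1.const_smul r, sineClosure.smul_mem r hF.2⟩

theorem isClosed_sineClosure : IsClosed (sineClosure : Set L1) :=
  Submodule.isClosed_topologicalClosure _

/-- With s = cos(πx), Weierstrass approximation of h(arccos(s)/π) on [-1,1] replaces h by a
polynomial in cos(πx), and such a polynomial times sin(πx) is a sine polynomial. -/
theorem sin_mul_real_mem_sineClosure {h : ℝ → ℝ} (hh : Continuous h) :
    contToL1 (fun x => ((h x * Real.sin (π * x) : ℝ) : ℂ)) (by fun_prop) ∈ sineClosure := by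
  rw [← SetLike.mem_coe, ← isClosed_sineClosure.closure_eq, Metric.mem_closure_iff]
  intro ε hε
  obtain ⟨p, hp⟩ := exists_polynomial_near_of_continuousOn (-1) 1
    (fun s => h (Real.arccos s / π)) (by fun_prop) (ε / 2) (half_pos hε)
  obtain ⟨hc, hmem⟩ := contToL1_mem_sineClosure (polynomial_mul_sin_mem_sinePolynomials p)
  refine ⟨_, hmem, ?_⟩
  have hsub : contToL1 (fun x => ((h x * Real.sin (π * x) : ℝ) : ℂ)) (by fun_prop) -
      contToL1 _ hc = contToL1 ((fun x => ((h x * Real.sin (π * x) : ℝ) : ℂ)) -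
        fun x => ((p.eval (Real.cos (π * x)) * Real.sin (π * x) : ℝ) : ℂ))
        (Continuous.sub (by fun_prop) hc) := rfl
  rw [dist_eq_norm, hsub, norm_contToL1]
  refine lt_of_le_of_lt ?_ (half_lt_self hε)
  have hle := norm_setIntegral_le_of_norm_le_const (μ := volume) (s := Ioo (0 : ℝ) 1)
    (f := fun x => ‖((fun x => ((h x * Real.sin (π * x) : ℝ) : ℂ)) -
        fun x => ((p.eval (Real.cos (π * x)) * Real.sin (π * x) : ℝ) : ℂ)) x‖) (C := ε / 2)
    (by simp) fun x hx => ?_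
  · simpa using (le_abs_self _).trans hle
  · have hx1 : Real.arccos (Real.cos (π * x)) / π = x := by
      rw [Real.arccos_cos (by have := hx.1; positivity)
        (mul_le_of_le_one_right Real.pi_pos.le hx.2.le)]
      field_simp
    have h1 := hp (Real.cos (π * x)) ⟨Real.neg_one_le_cos _, Real.cos_le_one _⟩
    rw [hx1] at h1
    rw [norm_norm, Pi.sub_apply, ← Complex.ofReal_sub, Complex.norm_real, ← sub_mul, norm_mul]
    calc ‖h x - p.eval (Real.cos (π * x))‖ * ‖Real.sin (π * x)‖ ≤ ε / 2 * 1 := by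
          refine mul_le_mul ?_ (Real.abs_sin_le_one _) (norm_nonneg _) (half_pos hε).le
          rw [norm_sub_rev]
          exact h1.le
      _ = ε / 2 := mul_one _

theorem sin_mul_mem_sineClosure {h : ℝ → ℂ} (hh : Continuous h) :
    contToL1 (fun x => (Real.sin (π * x) : ℝ) * h x) (by fun_prop) ∈ sineClosure := by
  have h1 := sin_mul_real_mem_sineClosure (Complex.continuous_re.comp hh)
  have h2 := sin_mul_real_mem_sineClosure (Complex.continuous_im.comp hh)
  have h3 := sineClosure.add_mem h1 (sineClosure.smul_mem Complex.I h2)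
  rw [← contToL1_smul, ← contToL1_add] at h3
  convert h3 using 2
  ext x
  simp only [Pi.add_apply, Pi.smul_apply, Function.comp_apply, smul_eq_mul]
  conv_lhs => rw [← Complex.re_add_im (h x)]
  push_cast
  ring

/-- The weight sin(πx) is positive inside the interval, so u = sin(πx) v with v integrable for the
measure sin(πx) dx. Approximating v by continuous g in that weighted space is the same as
approximating u by sin(πx) g in L_1. -/
theorem sineClosure_eq_top : sineClosure = ⊤ := by
  rw [eq_top_iff]
  intro u _
  rw [← SetLike.mem_coe, ← isClosed_sineClosure.closure_eq, Metric.mem_closure_iff]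
  intro ε hε
  set μ := volume.restrict (Ioo (0 : ℝ) 1) with hμ
  set w : ℝ → NNReal := fun x => Real.toNNReal (Real.sin (π * x)) with hw
  have hwm : Measurable w := by fun_prop
  have hwpos : ∀ x ∈ Ioo (0 : ℝ) 1, 0 < Real.sin (π * x) := fun x hx =>
    Real.sin_pos_of_pos_of_lt_pi (mul_pos Real.pi_pos hx.1)
      (mul_lt_of_lt_one_right Real.pi_pos hx.2)
  set ν := μ.withDensity fun x => (w x : ℝ≥0∞) with hν
  have hfin : IsFiniteMeasure ν := by
    refine isFiniteMeasure_withDensity_ofReal ?_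
    exact (integrable_Ioo_of_continuous (by fun_prop : Continuous fun x => Real.sin (π * x))).2
  have hvi : Integrable (fun x => (Real.sin (π * x) : ℂ)⁻¹ * u x) ν := by
    rw [hν, integrable_withDensity_iff_integrable_smul hwm]
    refine (L1.integrable_coeFn u).congr ?_
    filter_upwards [ae_restrict_mem measurableSet_Ioo] with x hx
    have h1 : (Real.sin (π * x) : ℂ) ≠ 0 := by exact_mod_cast (hwpos x hx).ne'
    rw [NNReal.smul_def, hw, Real.coe_toNNReal _ (hwpos x hx).le, Complex.real_smul,
      mul_inv_cancel_left₀ h1]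
  obtain ⟨g, -, hg, hgc, -⟩ := hvi.exists_hasCompactSupport_integral_sub_le (half_pos hε)
  refine ⟨_, sin_mul_mem_sineClosure hgc, ?_⟩
  rw [dist_eq_norm]
  refine lt_of_le_of_lt (le_of_eq_of_le ?_ hg) (half_lt_self hε)
  rw [L1.norm_eq_integral_norm, hν, integral_withDensity_eq_integral_smul hwm]
  refine integral_congr_ae ?_
  filter_upwards [ae_restrict_mem measurableSet_Ioo,
    Lp.coeFn_sub u (contToL1 (fun x => (Real.sin (π * x) : ℝ) * g x) (by fun_prop)),
    coeFn_contToL1 (F := fun x => (Real.sin (π * x) : ℝ) * g x) (by fun_prop)] with x hx h1 h2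
  have h3 : (Real.sin (π * x) : ℂ) ≠ 0 := by exact_mod_cast (hwpos x hx).ne'
  rw [h1, Pi.sub_apply, h2, NNReal.smul_def, hw, Real.coe_toNNReal _ (hwpos x hx).le, smul_eq_mul]
  have h4 : Real.sin (π * x) = ‖(Real.sin (π * x) : ℂ)‖ := by
    rw [Complex.norm_real, Real.norm_of_nonneg (hwpos x hx).le]
  have h5 : u x - Real.sin (π * x) * g x =
      Real.sin (π * x) * ((Real.sin (π * x) : ℂ)⁻¹ * u x - g x) := by
    rw [mul_sub, mul_inv_cancel_left₀ h3]
  rw [h5, norm_mul, ← h4]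

/-- The primitive of a sine mode is a combination of a cosine mode and a constant. Boundedness of
`integration` and density of sines then put all primitives in the closure, and adding constants
gives everything. -/
theorem dense_span_cosMode : Dense (Submodule.span ℂ (range cosMode) : Set W11) := by
  set S := (Submodule.span ℂ (range cosMode)).topologicalClosure with hS
  have hmode : ∀ n, cosMode n ∈ S := fun n =>
    Submodule.le_topologicalClosure _ (Submodule.subset_span ⟨n, rfl⟩)
  have hsin : ∀ n : ℕ, integration (contToL1 _ (continuous_sin_mode n)) ∈
      S := by
    intro n
    rcases Nat.eq_zero_or_pos n with rfl | hn
    · have : contToL1 _ (continuous_sin_mode 0) = 0 := by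
        refine Lp.ext ((coeFn_contToL1 (continuous_sin_mode 0)).trans ?_)
        filter_upwards [Lp.coeFn_zero ℂ 1 (volume.restrict (Ioo (0 : ℝ) 1))] with x hx
        rw [hx]
        simp
      rw [this, map_zero]
      exact S.zero_mem
    · have hn0 : (n * π : ℝ) ≠ 0 := by positivity
      have hd : (cosMode n).deriv = (-(n * π : ℝ) : ℂ) •
          contToL1 _ (continuous_sin_mode n) := by
        rw [← contToL1_smul]
        change contToL1 _ (continuous_deriv_cos_mode n) = _
        congr 1
        ext x
        simp
      obtain ⟨a, ha⟩ := (cosMode n).exists_eq_const_add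
      rw [hd, map_smul] at ha
      have hm := S.smul_mem (-(n * π : ℝ) : ℂ)⁻¹ (S.sub_mem (hmode n) (S.smul_mem a (hmode 0)))
      rwa [sub_eq_iff_eq_add'.mpr ha, inv_smul_smul₀] at hm
      exact neg_ne_zero.mpr (by exact_mod_cast hn0)
  have hint : ∀ g : L1, integration g ∈ S := by
    have hle : sineClosure ≤ S.comap (integration : L1 →ₗ[ℂ] W11) := by
      refine Submodule.topologicalClosure_minimal _ (Submodule.span_le.mpr ?_) ?_
      · rintro _ ⟨n, rfl⟩
        exact hsin n
      · exact (Submodule.isClosed_topologicalClosure _).preimage integration.continuous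
    intro g
    exact hle (by rw [sineClosure_eq_top]; trivial)
  rw [Submodule.dense_iff_topologicalClosure_eq_top, eq_top_iff]
  intro w _
  obtain ⟨a, ha⟩ := w.exists_eq_const_add
  rw [ha]
  exact S.add_mem (S.smul_mem a (hmode 0)) (hint _)

theorem isCosineSystem_cosMode : IsCosineSystem cosMode cosCoeff where
  biorth := cosCoeff_cosMode
  dense := dense_span_cosMode
  contraction := norm_cosine_family_le

/-! ### The Neumann operator is diagonal -/

/-- Continuous functions that agree almost everywhere on the open interval agree on its closure, so
the trace can be read from any continuous representative. -/
theorem HasTrace.eq_of_continuous {u : L1} {a : ℝ} {c : ℂ} (h : HasTrace u a c)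
    (ha : a ∈ Icc (0 : ℝ) 1) {F : ℝ → ℂ} (hF : Continuous F)
    (hu : u =ᵐ[volume.restrict (Ioo (0 : ℝ) 1)] F) : F a = c := by
  obtain ⟨U, hU, hUe, rfl⟩ := h
  have heq : EqOn U F (Ioo 0 1) :=
    Measure.eqOn_open_of_ae_eq (hUe.symm.trans hu) isOpen_Ioo
      (hU.mono Ioo_subset_Icc_self) hF.continuousOn
  have hcl : EqOn U F (Icc 0 1) :=
    heq.of_subset_closure hU hF.continuousOn Ioo_subset_Icc_self
      (by rw [closure_Ioo (zero_ne_one' ℝ)])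
  exact (hcl ha).symm

/-- Two integrations by parts: the first boundary terms vanish by the Neumann conditions, the second
because sin(nπx) vanishes at both ends. -/
theorem cosCoeff_of_mem_neumannGraph {x y : W11} (h : (x, y) ∈ neumannGraph) (n : ℕ) :
    cosCoeff n y = -((n * π : ℝ) : ℂ) ^ 2 * cosCoeff n x := by
  obtain ⟨⟨-, ht0, ht1⟩, hw⟩ := h
  simp only at ht0 ht1 hw
  -- The derivative of x is itself in W^1_1; its representative b + ∫y has b = 0 by the condition at
  -- 0 and ∫y = 0 over the interval by the condition at 1.
  set d : W11 := ⟨WithLp.toLp 1 (x.deriv, y.toL1), hw⟩ with hd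
  obtain ⟨b, hb⟩ := d.exists_eq_const_add
  have hrep : x.deriv =ᵐ[volume.restrict (Ioo (0 : ℝ) 1)] fun t => b + primitive y.toL1 t := by
    have h1 : x.deriv = (b • cosMode 0).toL1 + (integration y.toL1).toL1 :=
      congrArg W11.toL1 hb
    rw [h1]
    filter_upwards [Lp.coeFn_add (b • cosMode 0).toL1 (integration y.toL1).toL1,
      ((isRep_cosMode 0).smul b).toL1, toL1_integration y.toL1] with t h1 h2 h3
    rw [h1, Pi.add_apply, h2, h3]
    simp
  have hc : Continuous fun t => b + primitive y.toL1 t :=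
    continuous_const.add (continuous_primitive _)
  have hb0 : b = 0 := by
    simpa [primitive_zero] using ht0.eq_of_continuous (by simp) hc hrep
  have h10 : primitive y.toL1 1 = 0 := by
    simpa [hb0] using ht1.eq_of_continuous (by simp) hc hrep
  obtain ⟨a, ha⟩ := x.exists_eq_const_add
  have hxrep : x.toL1 =ᵐ[volume.restrict (Ioo (0 : ℝ) 1)] fun t => a + primitive x.deriv t := by
    have h1 : x.toL1 = (a • cosMode 0).toL1 + (integration x.deriv).toL1 :=
      congrArg W11.toL1 ha
    rw [h1]
    filter_upwards [Lp.coeFn_add (a • cosMode 0).toL1 (integration x.deriv).toL1,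
      ((isRep_cosMode 0).smul a).toL1, toL1_integration x.deriv] with t h1 h2 h3
    rw [h1, Pi.add_apply, h2, h3]
    simp
  have hsin1 : Real.sin (n * π * 1) = 0 := by rw [mul_one, Real.sin_nat_mul_pi]
  have e1 := integral_deriv_smul_primitive (hasDerivAt_cos_mode n) (by fun_prop) y.toL1
  have e2 := integral_deriv_smul_primitive (hasDerivAt_sin_mode n) (by fun_prop) x.deriv
  rw [h10, smul_zero, zero_sub] at e1
  rw [hsin1, zero_smul, zero_sub] at e2
  have e3 : ∫ t in Ioo (0 : ℝ) 1, (-(n * π) * Real.sin (n * π * t)) • primitive y.toL1 t =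
      (-(n * π : ℝ)) • ∫ t in Ioo (0 : ℝ) 1, Real.sin (n * π * t) • x.deriv t := by
    rw [← integral_smul]
    refine integral_congr_ae ?_
    filter_upwards [hrep] with t ht
    rw [ht, hb0, zero_add, smul_smul]
  have e4 : ∫ t in Ioo (0 : ℝ) 1, (n * π * Real.cos (n * π * t)) • primitive x.deriv t =
      (n * π : ℝ) • ∫ t in Ioo (0 : ℝ) 1, Real.cos (n * π * t) • x.toL1 t := by
    have h0 : ∫ t in Ioo (0 : ℝ) 1, n * π * Real.cos (n * π * t) = 0 := by
      rw [← integral_Ioc_eq_integral_Ioo, ← intervalIntegral.integral_of_le zero_le_one,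
        intervalIntegral.integral_eq_sub_of_hasDerivAt (fun t _ => hasDerivAt_sin_mode n t)
        (Continuous.intervalIntegrable (by fun_prop) _ _), hsin1]
      simp
    have h2 : ∫ t in Ioo (0 : ℝ) 1, (n * π * Real.cos (n * π * t)) • a = 0 := by
      rw [integral_smul_const, h0, zero_smul]
    have hi1 : Integrable (fun t => (n * π * Real.cos (n * π * t)) • a)
        (volume.restrict (Ioo (0 : ℝ) 1)) := integrable_Ioo_of_continuous (by fun_prop)
    have hi2 : Integrable (fun t => (n * π * Real.cos (n * π * t)) • primitive x.deriv t)
        (volume.restrict (Ioo (0 : ℝ) 1)) :=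
      integrable_Ioo_of_continuous
        (Continuous.smul (f := fun t : ℝ => n * π * Real.cos (n * π * t)) (by fun_prop)
          (continuous_primitive _))
    rw [← integral_smul, ← zero_add (∫ t in Ioo (0 : ℝ) 1, _), ← h2, ← integral_add hi1 hi2]
    refine integral_congr_ae ?_
    filter_upwards [hxrep] with t ht
    rw [ht, ← smul_add, smul_smul]
  rw [e3] at e1
  rw [e4] at e2
  rw [cosCoeff_apply, cosCoeff_apply, neg_eq_iff_eq_neg.mp e1.symm, ← neg_eq_iff_eq_neg.mpr e2]
  simp only [Complex.real_smul]
  push_cast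
  ring

theorem isDiagonal_neumannOp : IsDiagonal cosCoeff neumannOp := by
  intro x y
  rw [graph_neumannOp]
  refine ⟨cosCoeff_of_mem_neumannGraph, fun h => ?_⟩
  -- The relation for n = 0 says that y has mean zero, which is the Neumann condition at 1 for the
  -- double primitive w of y.
  have hy1 : primitive y.toL1 1 = 0 := by
    have := h 0
    rw [cosCoeff_apply] at this
    rw [primitive_one]
    simpa using this
  set v := integration y.toL1 with hv
  set w := integration v.toL1 with hw
  have hwd : w.deriv = v.toL1 := rfl
  have htr : w.deriv =ᵐ[volume.restrict (Ioo (0 : ℝ) 1)] primitive y.toL1 :=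
    toL1_integration y.toL1
  have hwy : (w, y) ∈ neumannGraph :=
    ⟨⟨⟨w.deriv, w.isWeakDeriv, y.toL1, v.isWeakDeriv, y.deriv, y.isWeakDeriv, trivial⟩,
      ⟨_, (continuous_primitive _).continuousOn, htr, primitive_zero _⟩,
      ⟨_, (continuous_primitive _).continuousOn, htr, hy1⟩⟩, v.isWeakDeriv⟩
  have h0 : (cosMode 0, (0 : W11)) ∈ neumannGraph := by
    have hd : IsWeakDeriv (cosMode 0).toL1 0 := by
      have := (cosMode 0).isWeakDeriv
      rwa [deriv_cosMode_zero] at this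
    refine ⟨⟨⟨0, hd, MemSobolev.zero 2⟩, ?_, ?_⟩, ?_⟩ <;> simp only [deriv_cosMode_zero]
    · exact HasTrace.zero 0
    · exact HasTrace.zero 1
    · exact IsWeakDeriv.zero
  -- For n ≥ 1 the factor (nπ)² is nonzero, so x and w share these coefficients and differ by a
  -- constant.
  have hx : x = w + cosCoeff 0 (x - w) • cosMode 0 := by
    refine isCosineSystem_cosMode.ext_coeff fun n => ?_
    rw [map_add, map_smul, cosCoeff_cosMode]
    rcases Nat.eq_zero_or_pos n with rfl | hn
    · simp
    · have h1 := (h n).symm.trans (cosCoeff_of_mem_neumannGraph hwy n)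
      have h2 : (-((n * π : ℝ) : ℂ) ^ 2) ≠ 0 := by
        have : (n * π : ℝ) ≠ 0 := by positivity
        exact neg_ne_zero.mpr (pow_ne_zero _ (by exact_mod_cast this))
      rw [mul_left_cancel₀ h2 h1, if_neg hn.ne']
      simp
  have := neumannGraph.add_mem hwy (neumannGraph.smul_mem (cosCoeff 0 (x - w)) h0)
  rw [hx]
  simpa using this

end Sobolev
end NeumannW11

end

theorem mainTheorem7 :
    NeumannW11.GeneratesAnalyticSemigroup NeumannW11.neumannOp ∧
      ∀ θ₀ : ℝ, θ₀ < Real.pi → ∀ l ∈ NeumannW11.closedSector θ₀, l ≠ 0 →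
        l ∈ NeumannW11.resolventSet NeumannW11.neumannOp ∧
          ∀ f : NeumannW11.W11,
            ‖NeumannW11.resolvent NeumannW11.neumannOp l f‖ ≤
              2 * ‖f‖ / (‖l‖ * Real.cos (θ₀ / 2)) := by
  have hS := NeumannW11.isCosineSystem_cosMode
  have hA := NeumannW11.isDiagonal_neumannOp
  refine ⟨hS.generatesAnalyticSemigroup hA, fun θ₀ hθ₀ l hl hl0 => ?_⟩
  obtain ⟨h1, h2⟩ := hS.resolvent_estimate hA hθ₀ hl hl0
  refine ⟨h1, fun f => (h2 f).trans ?_⟩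
  obtain ⟨θ, hθ, -⟩ := hl
  have hθ0 : 0 ≤ θ₀ := (abs_nonneg θ).trans hθ
  have hcos : 0 ≤ Real.cos (θ₀ / 2) := Real.cos_nonneg_of_mem_Icc ⟨by linarith, by linarith⟩
  -- The estimate already holds with constant 1; the factor 2 is slack.
  gcongr
  linarith [norm_nonneg f]
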